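/- Let $(M,g)$ be a smooth (Hausdorff) 4-manifold with a smooth Lorentzian metric of signature $(+,-,-,-)$, and let the curvature tensor be defined by $-R^\alpha{}_{\beta\gamma\delta}X^\beta Z^\gamma W^\delta=\nabla_Z\nabla_WX^\alpha-\nabla_W\nabla_ZX^\alpha-\nabla_{[Z,W]}X^\alpha$ with $\nabla$ the Levi-Civita connection. Let $q\in M$ and let $U$ be a convex normal neighbourhood of $q$, i.e. an open set such that $\exp_q$ is a diffeomorphism from some open neighbourhood $V$ of $0\in T_qM$ onto $U$, and any two points of $U$ are joined by a unique geodesic segment lying entirely in $U$. Let $X,Y\in T_qM$ be spacelike unit vectors orthogonal to each other: $g(X,X)=g(Y,Y)=-1$, $g(X,Y)=0$. Put $X(w):=\cos w\,X+\sin w\,Y$. Then for all sufficiently small $t\ge 0$ and $w\ge 0$ the points $\exp_q(tX)$ and $\exp_q(tX(w))$ are defined and lie in $U$; let $\chi$ be the geodesic segment in $U$ joining them and let $L[\chi]=\int\sqrt{|g(\dot\chi,\dot\chi)|}$ be its length, considered as a function of $(t,w)$. For all sufficiently small $t>0$ and $w\ge 0$, $$L[\chi]=t\,w\Bigl(1-\frac{t^2}{6}R_{abcd}X^aY^bX^cY^d+O(t^3)+O(w)\Bigr),$$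 where the constants in $O(t^3)$ and $O(w)$ do not depend on $t$ and $w$. Moreover, $L[\chi]$ is six times continuously differentiable on $[0,\varepsilon)\times[0,\varepsilon)$ for some $\varepsilon>0$, and, with one-sided derivatives at $0$, $$R_{abcd}X^aY^bX^cY^d=-\Bigl(\frac{\partial^4}{\partial t^3\partial w}L[\chi]\Bigr)_{t=w=0}=-\frac1{16}\Bigl(\frac{\partial^6}{\partial t^4\partial w^2}(L[\chi])^2\Bigr)_{t=w=0}.$$ -/

import Mathlib

open Set Manifold ContDiff

noncomputable section

/-- The model space `ℝ⁴`.  In Mathlib the tangent space at `x` of a manifold modelled on `ℝ⁴` is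
`ℝ⁴` itself, a tangent vector being identified with its components with respect to the preferred
chart `chartAt _ x` at `x`. -/
abbrev R4 : Type := EuclideanSpace ℝ (Fin 4)

/-- The matrix `diag(1, -1, -1, -1)`. -/
def minkowskiEta (i j : Fin 4) : ℝ := if i = j then (if i = 0 then 1 else -1) else 0

section Geometry

variable (M : Type*) [TopologicalSpace M] [ChartedSpace R4 M] [IsManifold (𝓡 4) ∞ M]

/-- A smooth Lorentzian metric of signature `(+,-,-,-)` on a smooth 4-manifold: a smooth symmetric
`(0,2)`-tensor field which at each point is `diag(1,-1,-1,-1)` in some basis. -/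
structure LorentzMetric where
  /-- the bilinear form on each tangent space -/
  val (x : M) : TangentSpace (𝓡 4) x →L[ℝ] TangentSpace (𝓡 4) x →L[ℝ] ℝ
  symm (x : M) (v w : TangentSpace (𝓡 4) x) : val x v w = val x w v
  signature (x : M) : ∃ b : Module.Basis (Fin 4) ℝ (TangentSpace (𝓡 4) x),
    ∀ i j, val x (b i) (b j) = minkowskiEta i j
  contMDiff : ContMDiff (𝓡 4) ((𝓡 4).prod 𝓘(ℝ, R4 →L[ℝ] R4 →L[ℝ] ℝ)) ∞
    (fun x ↦ Bundle.TotalSpace.mk' (R4 →L[ℝ] R4 →L[ℝ] ℝ)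
      (E := fun x : M ↦ TangentSpace (𝓡 4) x →L[ℝ] TangentSpace (𝓡 4) x →L[ℝ] ℝ) x (val x))

variable {M}

namespace LorentzMetric

variable (g : LorentzMetric M)

/-- The coordinate vector `∂ᵢ` of the preferred chart at `p`, at the point with coordinates `x`. -/
def coordVec (p : M) (x : R4) (i : Fin 4) :
    TangentSpace (𝓡 4) ((extChartAt (𝓡 4) p).symm x) :=
  mfderiv 𝓘(ℝ, R4) (𝓡 4) (extChartAt (𝓡 4) p).symm x (EuclideanSpace.single i (1 : ℝ) : R4)

/-- The metric components `g_{ij}(x) = g(∂ᵢ, ∂ⱼ)` in the preferred chart at `p`. -/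
def comp (p : M) (x : R4) : Matrix (Fin 4) (Fin 4) ℝ :=
  Matrix.of fun i j ↦ g.val ((extChartAt (𝓡 4) p).symm x) (coordVec p x i) (coordVec p x j)

/-- The partial derivative `∂ₗ f` of a function of the coordinates. -/
def pd (l : Fin 4) (f : R4 → ℝ) (x : R4) : ℝ :=
  fderiv ℝ f x (EuclideanSpace.single l (1 : ℝ))

/-- Christoffel symbols of the Levi-Civita connection in the preferred chart at `p`:
`Γᵏᵢⱼ = ½ gᵏˡ (∂ᵢ gⱼₗ + ∂ⱼ gᵢₗ - ∂ₗ gᵢⱼ)`. -/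
def christoffel (p : M) (k i j : Fin 4) (x : R4) : ℝ :=
  (1 / 2) * ∑ l, (g.comp p x)⁻¹ k l *
    (pd i (fun y ↦ g.comp p y j l) x + pd j (fun y ↦ g.comp p y i l) x
      - pd l (fun y ↦ g.comp p y i j) x)

/-- Components `Rᵃ_{bcd}` of the curvature tensor in the preferred chart at `p`, with the sign
convention `-Rᵃ_{bcd} Xᵇ Zᶜ Wᵈ = ∇_Z ∇_W Xᵃ - ∇_W ∇_Z Xᵃ - ∇_{[Z,W]} Xᵃ`. -/
def riemann (p : M) (a b c d : Fin 4) (x : R4) : ℝ :=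
  -(pd c (g.christoffel p a d b) x - pd d (g.christoffel p a c b) x
    + ∑ e, (g.christoffel p a c e x * g.christoffel p e d b x
      - g.christoffel p a d e x * g.christoffel p e c b x))

/-- The number `R_{abcd} Xᵃ Yᵇ Xᶜ Yᵈ` for `X, Y` tangent vectors at `q`, where
`R_{abcd} = g_{ae} Rᵉ_{bcd}`.  It is computed in the preferred chart at `q`, in which the
components of a tangent vector at `q` are simply its coordinates. -/
def sectional (q : M) (X Y : TangentSpace (𝓡 4) q) : ℝ :=
  let x : R4 := extChartAt (𝓡 4) q q
  let X' : R4 := X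
  let Y' : R4 := Y
  ∑ a, ∑ b, ∑ c, ∑ d, (∑ e, g.comp q x a e * g.riemann q e b c d x) * X' a * Y' b * X' c * Y' d

/-- The tangent vector `γ'(u)` of a curve. -/
def velocity (γ : ℝ → M) (u : ℝ) : TangentSpace (𝓡 4) (γ u) :=
  mfderiv 𝓘(ℝ, ℝ) (𝓡 4) γ u (1 : ℝ)

/-- `γ` is an (affinely parametrized) geodesic at all parameters in `s`: it is `C²` around each
`u ∈ s` and satisfies there `c'' ᵏ + Γᵏᵢⱼ c' ⁱ c' ʲ = 0` in the charts around `γ u`. -/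
def IsGeodesicOn (γ : ℝ → M) (s : Set ℝ) : Prop :=
  ∀ u ∈ s, ContMDiffAt 𝓘(ℝ, ℝ) (𝓡 4) 2 γ u ∧
    ∀ p : M, γ u ∈ (chartAt R4 p).source →
      let c : ℝ → R4 := fun v ↦ extChartAt (𝓡 4) p (γ v)
      ∀ k : Fin 4, deriv (deriv fun v ↦ c v k) u
        + ∑ i, ∑ j, g.christoffel p k i j (c u)
          * deriv (fun v ↦ c v i) u * deriv (fun v ↦ c v j) u = 0

/-- `γ : [0,1] → M` is a geodesic that starts at `q` with initial tangent vector `v`. -/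
def IsGeodesicFrom (q : M) (v : TangentSpace (𝓡 4) q) (γ : ℝ → M) : Prop :=
  g.IsGeodesicOn γ (Icc 0 1) ∧
    (⟨γ 0, velocity γ 0⟩ : TangentBundle (𝓡 4) M) = ⟨q, v⟩

/-- The domain of the exponential map at `q`. -/
def expDomain (q : M) : Set (TangentSpace (𝓡 4) q) := {v | ∃ γ, g.IsGeodesicFrom q v γ}

open Classical in
/-- The exponential map at `q`: `exp_q(v) = γ(1)` for the geodesic `γ` starting at `q` with
tangent vector `v` (and the irrelevant value `q` outside its domain). -/
def exp (q : M) (v : TangentSpace (𝓡 4) q) : M :=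
  if h : ∃ γ, g.IsGeodesicFrom q v γ then h.choose 1 else q

/-- `χ : [0,1] → M` is a geodesic segment from `p` to `r` that lies entirely in `U`. -/
def IsGeodesicSegment (U : Set M) (p r : M) (χ : ℝ → M) : Prop :=
  g.IsGeodesicOn χ (Icc 0 1) ∧ χ 0 = p ∧ χ 1 = r ∧ MapsTo χ (Icc 0 1) U

/-- The length `∫ √|g(χ', χ')|` of a curve defined on `[0,1]`. -/
def length (χ : ℝ → M) : ℝ :=
  ∫ u in (0 : ℝ)..1, Real.sqrt |g.val (χ u) (velocity χ u) (velocity χ u)|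

/-- `U` is a convex normal neighbourhood of `q`: the exponential map at `q` is a diffeomorphism
from an open neighbourhood `V` of `0` in the tangent space at `q` onto the open set `U`, and any
two points of `U` are joined by a unique geodesic segment lying entirely in `U`.  (`V` is written
as a subset of the model space, which is the tangent space at `q`, because that carries the manifold
structure of a vector space.) -/
structure IsConvexNormalNhd (q : M) (U : Set M) : Prop where
  isOpen : IsOpen U
  exists_diffeo : ∃ (V : Set R4) (log : M → R4), IsOpen V ∧ (0 : R4) ∈ V ∧
    V ⊆ g.expDomain q ∧ BijOn (fun v : R4 ↦ g.exp q v) V U ∧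
    InvOn log (fun v : R4 ↦ g.exp q v) V U ∧
    ContMDiffOn 𝓘(ℝ, R4) (𝓡 4) ∞ (fun v : R4 ↦ g.exp q v) V ∧
    ContMDiffOn (𝓡 4) 𝓘(ℝ, R4) ∞ log U
  exists_unique_geodesic : ∀ p ∈ U, ∀ r ∈ U, ∃ χ, g.IsGeodesicSegment U p r χ ∧
    ∀ χ', g.IsGeodesicSegment U p r χ' → EqOn χ' χ (Icc 0 1)

end LorentzMetric

end Geometry

end

/-! ### Calculus tools: cut-offs, superposition operators, Hadamard's lemma -/

section

open Filter Topology

/-! In the chart at `q` the end points of `χ` are `e(tX)` and `e(tX(w))`, where `e` is `exp_q` read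
in coordinates. Since `X(w) = X + w ρ(w)` with `ρ` smooth and `ρ(0) = Y`, Hadamard's lemma gives
`e(tX(w)) = e(tX) + tw ψ(t,w)` with `ψ` smooth and `ψ(t,0) = De(tX)Y`. So the end points differ by
exactly `tw` times a smooth vector, even though the problem degenerates on both axes.

The boundary value problem is then solved uniformly down to `l = tw = 0` (`exists_geodesic_family`):
the geodesic from `p` to `p + lξ` has initial velocity `l(ξ + l v)`, where `v` depends on `(p, l,
ξ)` as smoothly as needed. A geodesic has constant speed, so its length is the initial speed, and `L
= tw S(t,w)` with `S = √H`, where `-H` is the square norm of `ψ + tw v`. As `H(0) = -g(Y,Y) = 1`,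
the root is smooth near the origin; this is where the differentiability of `L` comes from.

On `w = 0` one has `S(t,0)² = -G(η,η)` with `η(t) = De(tX)Y`, and `tη` is the Jacobi field of the
variation of radial geodesics. The Jacobi equation shows that the covariant derivative of `η`
vanishes at `0` and has there the derivative `R(X,Y)X / 3` (`IsLeviCivitaOn.deriv_deriv_jacobi`).
With `K = R_{abcd}X^aY^bX^cY^d = G(R(X,Y)X, Y)` (`LorentzMetric.sectional_eq`) this gives `S(t,0) =
1 - K t²/6 + O(t³)`. The expansion and both derivative formulas follow from `L = tw S` by calculus
in two variables (`length_expansion`).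

The link with the manifold is made by chart independence of the geodesic equation (the metrics in
two charts are isometric under the transition map), uniqueness for the initial value problem (which
identifies `exp_q(tv)` with the geodesic itself), and uniqueness of segments in `U`, which forces
`χ` to be the curve constructed in the chart. -/

theorem ContDiffOn.exists_contDiff_eventuallyEq {E F : Type*} [NormedAddCommGroup E]
    [NormedSpace ℝ E] [FiniteDimensional ℝ E] [NormedAddCommGroup F] [NormedSpace ℝ F]
    {n : ℕ∞} {f : E → F} {s : Set E} {x : E} (hf : ContDiffOn ℝ n f s) (hs : s ∈ 𝓝 x) :
    ∃ f' : E → F, ContDiff ℝ n f' ∧ f' =ᶠ[𝓝 x] f := by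
  obtain ⟨r, hr, hrs⟩ := Metric.mem_nhds_iff.1 hs
  let b : ContDiffBump x := ⟨r / 4, r / 2, by positivity, by linarith⟩
  refine ⟨fun y ↦ b y • f y, ?_, ?_⟩
  · rw [contDiff_iff_contDiffAt]
    intro y
    by_cases hy : y ∈ Metric.ball x r
    · exact b.contDiffAt.smul (hf.contDiffAt (mem_of_superset (Metric.isOpen_ball.mem_nhds hy) hrs))
    · have : y ∈ (Metric.closedBall x (r / 2))ᶜ := by
        simp only [Metric.mem_ball, not_lt, mem_compl_iff, Metric.mem_closedBall, not_le] at hy ⊢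
        linarith
      refine (contDiffAt_const (c := (0 : F))).congr_of_eventuallyEq ?_
      filter_upwards [Metric.isClosed_closedBall.isOpen_compl.mem_nhds this] with z hz
      have : b z = 0 := by
        refine b.zero_of_le_dist ?_
        simp only [mem_compl_iff, Metric.mem_closedBall, not_le] at hz
        exact hz.le
      simp [this]
  · filter_upwards [b.eventuallyEq_one] with y hy
    simp [hy]

section Superposition

variable {K : Type*} [TopologicalSpace K] [CompactSpace K]

/-- The superposition operator `u ↦ f ∘ u` on continuous functions (zero if `f` is not
continuous). -/
noncomputable def superposition {E F : Type*} [TopologicalSpace E] [TopologicalSpace F]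
    (f : C(E, F)) (u : C(K, E)) : C(K, F) := f.comp u

/-- Pointwise application of an operator-valued function, as a bounded bilinear map. -/
noncomputable def pointwiseApplyL (K : Type*) [TopologicalSpace K] [CompactSpace K] (E F : Type*)
    [NormedAddCommGroup E] [NormedSpace ℝ E] [NormedAddCommGroup F] [NormedSpace ℝ F] :
    C(K, E →L[ℝ] F) →L[ℝ] C(K, E) →L[ℝ] C(K, F) :=
  LinearMap.mkContinuous₂
    (LinearMap.mk₂ ℝ (fun (A : C(K, E →L[ℝ] F)) (u : C(K, E)) ↦
        (⟨fun x ↦ A x (u x), by fun_prop⟩ : C(K, F)))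
      (fun _ _ _ ↦ by ext; simp) (fun _ _ _ ↦ by ext; simp)
      (fun _ _ _ ↦ by ext; simp) (fun _ _ _ ↦ by ext; simp)) 1
    (fun A u ↦ by
      rw [one_mul]
      refine (ContinuousMap.norm_le _ (by positivity)).2 fun x ↦ ?_
      exact (A x).le_of_opNorm_le_of_le (A.norm_coe_le_norm x) (u.norm_coe_le_norm x))

@[simp]
theorem pointwiseApplyL_apply {E F : Type*} [NormedAddCommGroup E] [NormedSpace ℝ E]
    [NormedAddCommGroup F] [NormedSpace ℝ F] (A : C(K, E →L[ℝ] F)) (u : C(K, E)) (x : K) :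
    pointwiseApplyL K E F A u x = A x (u x) := rfl

/-- Composition with `f'` is continuous for the sup norm because `K` is compact. Hence a small `h`
makes `f'` vary by less than `c` along the segments from `u x` to `u x + h x`, uniformly in `x`, and
the mean value inequality gives the little-o bound uniformly. -/
theorem hasFDerivAt_superposition {E F : Type*} [NormedAddCommGroup E] [NormedSpace ℝ E]
    [NormedAddCommGroup F] [NormedSpace ℝ F] {f : C(E, F)} {f' : C(E, E →L[ℝ] F)}
    (hf : ∀ x, HasFDerivAt f (f' x) x) (u : C(K, E)) :
    HasFDerivAt (superposition f) (pointwiseApplyL K E F (superposition f' u)) u := by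
  rw [hasFDerivAt_iff_isLittleO_nhds_zero, Asymptotics.isLittleO_iff]
  intro c hc
  have hcont : Continuous (fun v : C(K, E) ↦ superposition f' v) :=
    ContinuousMap.continuous_postcomp f'
  have hu : ∀ᶠ v in 𝓝 u, superposition f' v ∈ Metric.ball (superposition f' u) c :=
    hcont.continuousAt.eventually (Metric.isOpen_ball.eventually_mem (Metric.mem_ball_self hc))
  obtain ⟨δ, hδ, hball⟩ := Metric.eventually_nhds_iff.1 hu
  filter_upwards [Metric.ball_mem_nhds (0 : C(K, E)) hδ] with h hh
  rw [mem_ball_zero_iff] at hh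
  refine (ContinuousMap.norm_le _ (by positivity)).2 fun x ↦ ?_
  have key : ∀ y ∈ segment ℝ (u x) (u x + h x), ‖f' y - f' (u x)‖ ≤ c := by
    intro y hy
    rw [segment_eq_image'] at hy
    obtain ⟨θ, ⟨hθ0, hθ1⟩, rfl⟩ := hy
    have h1 : dist (u + θ • h) u < δ := by
      rw [dist_eq_norm, add_sub_cancel_left, norm_smul, Real.norm_of_nonneg hθ0]
      exact (mul_le_of_le_one_left (norm_nonneg _) hθ1).trans_lt hh
    have h2 := (ContinuousMap.dist_apply_le_dist x).trans_lt (hball h1)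
    rw [dist_eq_norm] at h2
    simpa [superposition] using h2.le
  have := (convex_segment (u x) (u x + h x)).norm_image_sub_le_of_norm_hasFDerivWithin_le'
    (fun y _ ↦ (hf y).hasFDerivWithinAt) key (left_mem_segment ℝ _ _) (right_mem_segment ℝ _ _)
  rw [add_sub_cancel_left] at this
  refine le_trans ?_ (this.trans (mul_le_mul_of_nonneg_left (h.norm_coe_le_norm x) hc.le))
  simp [superposition]

/-- The derivative is again a superposition operator, with `f'` in place of `f`, followed by the
bounded bilinear map `pointwiseApplyL`; so induction applies. The target changes from `F` to `E
→L[ℝ] F`, which is why both spaces lie in one universe. -/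
theorem contDiff_superposition_nat (n : ℕ) {E F : Type u} [NormedAddCommGroup E] [NormedSpace ℝ E]
    [NormedAddCommGroup F] [NormedSpace ℝ F] (f : C(E, F)) (hf : ContDiff ℝ n f) :
    ContDiff ℝ n (superposition (K := K) f) := by
  induction n generalizing F with
  | zero =>
    rw [Nat.cast_zero, contDiff_zero]
    exact ContinuousMap.continuous_postcomp f
  | succ n ih =>
    rw [Nat.cast_succ] at hf ⊢
    have h := (contDiff_succ_iff_fderiv.1 hf)
    let f' : C(E, E →L[ℝ] F) := ⟨fderiv ℝ f, h.2.2.continuous⟩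
    have hd : ∀ u : C(K, E), HasFDerivAt (superposition f)
        (pointwiseApplyL K E F (superposition f' u)) u :=
      hasFDerivAt_superposition fun x ↦ (h.1 x).hasFDerivAt
    rw [contDiff_succ_iff_fderiv]
    refine ⟨fun u ↦ (hd u).differentiableAt, by simp, ?_⟩
    have : fderiv ℝ (superposition (K := K) f)
        = fun u ↦ pointwiseApplyL K E F (superposition f' u) := funext fun u ↦ (hd u).fderiv
    rw [this]
    exact (pointwiseApplyL K E F).contDiff.comp (ih f' h.2.2)

theorem contDiff_superposition {E F : Type u} [NormedAddCommGroup E] [NormedSpace ℝ E]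
    [NormedAddCommGroup F] [NormedSpace ℝ F] (f : C(E, F)) (hf : ContDiff ℝ ∞ f) :
    ContDiff ℝ ∞ (superposition (K := K) f) :=
  contDiff_infty.2 fun n ↦ contDiff_superposition_nat n f (contDiff_infty.1 hf n)

end Superposition

section Primitive

theorem continuous_iccExtend {E : Type*} [TopologicalSpace E] (z : C(Icc (0 : ℝ) 1, E)) :
    Continuous (IccExtend (zero_le_one (α := ℝ)) z) := z.continuous.Icc_extend'

variable {E : Type*} [NormedAddCommGroup E] [NormedSpace ℝ E]

/-- The primitive `s ↦ ∫₀ˢ z` of a continuous function on `[0,1]` (extended by constants to `ℝ`). -/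
noncomputable def primitive (z : C(Icc (0 : ℝ) 1, E)) (s : ℝ) : E :=
  ∫ τ in (0 : ℝ)..s, IccExtend zero_le_one z τ

theorem hasDerivAt_primitive [CompleteSpace E] (z : C(Icc (0 : ℝ) 1, E)) (s : ℝ) :
    HasDerivAt (primitive z) (IccExtend zero_le_one z s) s :=
  (continuous_iccExtend z).integral_hasStrictDerivAt 0 s |>.hasDerivAt

/-- The primitive of a continuous function on `[0,1]`, as a bounded operator. -/
noncomputable def primitiveL [CompleteSpace E] :
    C(Icc (0 : ℝ) 1, E) →L[ℝ] C(Icc (0 : ℝ) 1, E) :=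
  LinearMap.mkContinuous
    { toFun := fun z ↦ ⟨fun s ↦ primitive z s, by
        have : Continuous (primitive z) := continuous_iff_continuousAt.2 fun s ↦
          (hasDerivAt_primitive z s).continuousAt
        fun_prop⟩
      map_add' := fun z z' ↦ by
        ext s
        exact intervalIntegral.integral_add ((continuous_iccExtend z).intervalIntegrable _ _)
          ((continuous_iccExtend z').intervalIntegrable _ _)
      map_smul' := fun c z ↦ by
        ext s
        exact intervalIntegral.integral_smul c _ } 1
    (fun z ↦ by
      refine (ContinuousMap.norm_le _ (by positivity)).2 fun s ↦ ?_
      have := intervalIntegral.norm_integral_le_of_norm_le_const (a := (0 : ℝ)) (b := s)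
        (f := IccExtend zero_le_one z) (C := ‖z‖) (fun τ _ ↦ z.norm_coe_le_norm _)
      refine this.trans ?_
      rw [sub_zero, abs_of_nonneg s.2.1, one_mul]
      exact mul_le_of_le_one_right (norm_nonneg _) s.2.2)

end Primitive

/-- **Hadamard's lemma**. -/
theorem ContDiff.exists_hadamard {E F : Type u} [NormedAddCommGroup E] [NormedSpace ℝ E]
    [NormedAddCommGroup F] [NormedSpace ℝ F] [CompleteSpace F] {f : E → F} (hf : ContDiff ℝ ∞ f) :
    ∃ A : E × E → E →L[ℝ] F, ContDiff ℝ ∞ A ∧ (∀ a, A (a, 0) = fderiv ℝ f a) ∧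
      ∀ a h, f (a + h) - f a = A (a, h) h := by
  have hf' : ContDiff ℝ ∞ (fderiv ℝ f) := hf.fderiv_right (by simp)
  let f' : C(E, E →L[ℝ] F) := ⟨fderiv ℝ f, hf'.continuous⟩
  -- `J` is integration over `[0,1]`. The usual `A(a,h) = ∫₀¹ f'(a + sh) ds` becomes bounded linear
  -- maps composed with the superposition operator of `f'`, so that its smoothness needs no
  -- differentiation under the integral.
  let J : C(Icc (0 : ℝ) 1, E →L[ℝ] F) →L[ℝ] E →L[ℝ] F :=
    (ContinuousMap.evalCLM ℝ (1 : Icc (0 : ℝ) 1)).comp primitiveL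
  let c : E →L[ℝ] C(Icc (0 : ℝ) 1, E) := ContinuousLinearMap.const ℝ _
  let m : E →L[ℝ] C(Icc (0 : ℝ) 1, E) := (pointwiseApplyL (Icc (0 : ℝ) 1) E E
    ⟨fun s ↦ (s : ℝ) • ContinuousLinearMap.id ℝ E, by fun_prop⟩).comp c
  have hJ : ∀ (g : ℝ → E →L[ℝ] F) (z : C(Icc (0 : ℝ) 1, E →L[ℝ] F)), (∀ s, z s = g s) →
      J z = ∫ s in (0 : ℝ)..1, g s := by
    intro g z hz
    refine intervalIntegral.integral_congr fun s hs ↦ ?_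
    replace hs : s ∈ Icc (0 : ℝ) 1 := uIcc_of_le (zero_le_one (α := ℝ)) ▸ hs
    rw [IccExtend_of_mem _ _ hs, hz]
  have hA : ∀ a h, J (superposition f' (c a + m h))
      = ∫ s in (0 : ℝ)..1, fderiv ℝ f (a + s • h) := fun a h ↦ hJ _ _ fun s ↦ rfl
  refine ⟨fun x ↦ J (superposition f' (c x.1 + m x.2)), ?_, fun a ↦ ?_, fun a h ↦ ?_⟩
  · exact J.contDiff.comp ((contDiff_superposition f' hf').comp
      ((c.contDiff.comp contDiff_fst).add (m.contDiff.comp contDiff_snd)))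
  · simp only [hA]
    simp
  · have hcont : Continuous fun s : ℝ ↦ fderiv ℝ f (a + s • h) :=
      hf'.continuous.comp (by fun_prop)
    simp only [hA]
    rw [ContinuousLinearMap.intervalIntegral_apply (hcont.intervalIntegrable _ _)]
    rw [intervalIntegral.integral_eq_sub_of_hasDerivAt (f := fun s : ℝ ↦ f (a + s • h))]
    · simp
    · intro s _
      have h1 : HasDerivAt (fun s : ℝ ↦ a + s • h) h s := by
        simpa using ((hasDerivAt_id s).smul_const h).const_add a
      exact ((hf.differentiable (by simp)) _).hasFDerivAt.comp_hasDerivAt s h1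
    · exact (hcont.clm_apply continuous_const).intervalIntegrable _ _

end

/-! ### The boundary value problem for short geodesics -/

section

open Filter Topology

/-- **The boundary value problem for geodesics.**  For a smooth Christoffel form `Γ`, the points `p`
and `p + l ξ` are joined by a solution of the geodesic equation, for `(p, l, ξ)` near `(x₀, 0, ξ₀)`,
whose initial velocity `l (ξ + l v)` depends smoothly on the parameters. -/
theorem exists_geodesic_family {E : Type u} [NormedAddCommGroup E] [NormedSpace ℝ E]
    [CompleteSpace E] {Γ : E → E →L[ℝ] E →L[ℝ] E} (hΓ : ContDiff ℝ ∞ Γ) (x₀ ξ₀ : E) (n : ℕ)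
    (hn : n ≠ 0) :
    ∃ (v : E × ℝ × E → E) (u : E × ℝ × E → ℝ → E), ContDiffAt ℝ n v (x₀, 0, ξ₀) ∧
      (∀ᶠ a in 𝓝 (x₀, (0 : ℝ), ξ₀), u a 0 = a.1 ∧ u a 1 = a.1 + a.2.1 • a.2.2 ∧
        ContDiff ℝ 2 (u a) ∧ deriv (u a) 0 = a.2.1 • (a.2.2 + a.2.1 • v a) ∧
        ∀ s ∈ Icc (0 : ℝ) 1,
          deriv (deriv (u a)) s + Γ (u a s) (deriv (u a) s) (deriv (u a) s) = 0) ∧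
      ∀ N ∈ 𝓝 x₀, ∀ᶠ a in 𝓝 (x₀, (0 : ℝ), ξ₀), ∀ s ∈ Icc (0 : ℝ) 1, u a s ∈ N := by
  have hn' : (n : ℕ∞ω) ≠ 0 := by exact_mod_cast hn
  let I := Icc (0 : ℝ) 1
  let c : E →L[ℝ] C(I, E) := ContinuousLinearMap.const ℝ _
  let id' : C(I, E →L[ℝ] E) := ⟨fun s ↦ (s : ℝ) • ContinuousLinearMap.id ℝ E, by fun_prop⟩
  let m : E →L[ℝ] C(I, E) := (pointwiseApplyL I E E id').comp c
  let P : C(I, E) →L[ℝ] C(I, E) := primitiveL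
  let ev : C(I, E) →L[ℝ] E := ContinuousMap.evalCLM ℝ (1 : I)
  -- The unknown is the rescaled acceleration `z = u'' / l²`. `G z` is the solution of `y'' = z`
  -- with `y(0) = y(1) = 0`, and `G' z` is its derivative. Thus `U = p + s l ξ + l² G z` has the
  -- right end points, its velocity is `l U'` with `U' = ξ + l G' z`, and the geodesic equation
  -- divided by `l²` is `z + Γ(U)(U', U') = 0`, which stays meaningful at `l = 0`.
  let G' : C(I, E) →L[ℝ] C(I, E) := P - c.comp (ev.comp (P.comp P))
  let G : C(I, E) →L[ℝ] C(I, E) := P.comp P - m.comp (ev.comp (P.comp P))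
  let f : C(E × E, E) := ⟨fun y ↦ Γ y.1 y.2 y.2, by have := hΓ.continuous; fun_prop⟩
  have hf : ContDiff ℝ ∞ f := by
    change ContDiff ℝ ∞ fun y : E × E ↦ Γ y.1 y.2 y.2
    exact ((hΓ.comp contDiff_fst).clm_apply contDiff_snd).clm_apply contDiff_snd
  let inl : C(I, E) →L[ℝ] C(I, E × E) :=
    (ContinuousLinearMap.inl ℝ E E).compLeftContinuous ℝ I
  let inr : C(I, E) →L[ℝ] C(I, E × E) :=
    (ContinuousLinearMap.inr ℝ E E).compLeftContinuous ℝ I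
  let U : (E × ℝ × E) × C(I, E) → C(I, E) := fun y ↦
    c y.1.1 + y.1.2.1 • m y.1.2.2 + (y.1.2.1 ^ 2) • G y.2
  let U' : (E × ℝ × E) × C(I, E) → C(I, E) := fun y ↦ c y.1.2.2 + y.1.2.1 • G' y.2
  have hU : ContDiff ℝ ∞ U := by fun_prop
  have hU' : ContDiff ℝ ∞ U' := by fun_prop
  let F : (E × ℝ × E) × C(I, E) → C(I, E) := fun y ↦
    y.2 + superposition f (inl (U y) + inr (U' y))
  have hF : ContDiff ℝ ∞ F := contDiff_snd.add ((contDiff_superposition f hf).comp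
    ((inl.contDiff.comp hU).add (inr.contDiff.comp hU')))
  let a₀ : E × ℝ × E := (x₀, 0, ξ₀)
  let z₀ : C(I, E) := -superposition f (inl (c x₀) + inr (c ξ₀))
  -- At `l = 0` neither `U` nor `U'` involves `z`. So `F` is a translation in `z`, its partial
  -- derivative is the identity, and the implicit function theorem applies.
  have hFa₀ : ∀ z, F (a₀, z) = z - z₀ := by
    intro z
    simp [F, U, U', a₀, z₀]
  have hF₀ : F (a₀, z₀) = 0 := by rw [hFa₀, sub_self]
  have hinv : (fderiv ℝ F (a₀, z₀) ∘L .inr ℝ (E × ℝ × E) C(I, E)).IsInvertible := by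
    have h1 : HasFDerivAt (fun z ↦ F (a₀, z)) (fderiv ℝ F (a₀, z₀) ∘L .inr ℝ (E × ℝ × E) C(I, E))
        z₀ := ((hF.differentiable (by simp)) (a₀, z₀)).hasFDerivAt.comp z₀
          (hasFDerivAt_prodMk_right a₀ z₀)
    have h2 : HasFDerivAt (fun z ↦ F (a₀, z)) (ContinuousLinearMap.id ℝ C(I, E)) z₀ := by
      simp only [hFa₀]
      exact (hasFDerivAt_id z₀).sub_const z₀
    rw [h1.unique h2]
    exact ⟨ContinuousLinearEquiv.refl ℝ _, rfl⟩
  have hFn : ContDiffAt ℝ n F (a₀, z₀) := (contDiff_infty.1 hF n).contDiffAt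
  obtain ⟨z, hz, hz₀, hFz⟩ : ∃ z : E × ℝ × E → C(I, E), ContDiffAt ℝ n z a₀ ∧ z a₀ = z₀ ∧
      ∀ᶠ a in 𝓝 a₀, F (a, z a) = 0 :=
    ⟨hFn.implicitFunction hn' hinv, hFn.contDiffAt_implicitFunction hn' hinv,
      hFn.implicitFunction_apply_self hn' hinv, by
        simpa [hF₀] using hFn.eventually_apply_implicitFunction hn' hinv⟩
  -- The double primitive on all of `ℝ`, with `z` extended by constants: it makes `u` of class `C²`
  -- in the two-sided sense at the ends of `[0,1]` too.
  let w : C(I, E) → ℝ → E := fun z s ↦ ∫ τ in (0 : ℝ)..s, primitive z τ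
  have hprim : ∀ z : C(I, E), Continuous (primitive z) := fun z ↦
    continuous_iff_continuousAt.2 fun s ↦ (hasDerivAt_primitive z s).continuousAt
  have hw : ∀ z s, HasDerivAt (w z) (primitive z s) s := fun z s ↦
    ((hprim z).integral_hasStrictDerivAt 0 s).hasDerivAt
  have hwI : ∀ z (s : I), w z s = P (P z) s := by
    intro z s
    refine intervalIntegral.integral_congr fun τ hτ ↦ ?_
    rw [uIcc_of_le s.2.1] at hτ
    exact (IccExtend_of_mem zero_le_one (P z) (⟨hτ.1, hτ.2.trans s.2.2⟩ : τ ∈ I)).symm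
  have hw1 : ∀ z, w z 1 = ev (P (P z)) := fun z ↦ hwI z 1
  let u : E × ℝ × E → ℝ → E := fun a s ↦
    a.1 + s • (a.2.1 • a.2.2) + a.2.1 ^ 2 • (w (z a) s - s • ev (P (P (z a))))
  let u' : E × ℝ × E → ℝ → E := fun a s ↦
    a.2.1 • (a.2.2 + a.2.1 • (primitive (z a) s - ev (P (P (z a)))))
  have hu : ∀ a s, HasDerivAt (u a) (u' a s) s := by
    intro a s
    have h1 := ((hasDerivAt_id s).smul_const (a.2.1 • a.2.2)).const_add a.1
    have h2 := ((hw (z a) s).sub ((hasDerivAt_id s).smul_const (ev (P (P (z a)))))).const_smul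
      (a.2.1 ^ 2)
    refine (h1.add h2).congr_deriv ?_
    simp only [u']
    module
  have hu' : ∀ a s, HasDerivAt (u' a) (a.2.1 ^ 2 • IccExtend zero_le_one (z a) s) s := by
    intro a s
    refine (((((hasDerivAt_primitive (z a) s).sub_const _).const_smul _).const_add _).const_smul
      _).congr_deriv ?_
    module
  have hdu : ∀ a, deriv (u a) = u' a := fun a ↦ funext fun s ↦ (hu a s).deriv
  have hdu' : ∀ a, deriv (u' a) = fun s ↦ a.2.1 ^ 2 • IccExtend zero_le_one (z a) s :=
    fun a ↦ funext fun s ↦ (hu' a s).deriv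
  have huI : ∀ a (s : I), u a s = U (a, z a) s := by
    intro a s
    simp only [u, hwI]
    simp [U, G, m, c, id', smul_smul, mul_comm]
  have huI' : ∀ a (s : I), u' a s = a.2.1 • U' (a, z a) s := fun a s ↦ rfl
  refine ⟨fun a ↦ -ev (P (P (z a))), u, ?_, ?_, ?_⟩
  · exact ((ev.comp (P.comp P)).contDiff.contDiffAt.comp a₀ hz).neg
  · filter_upwards [hFz] with a ha
    refine ⟨?_, ?_, ?_, ?_, ?_⟩
    · simp [u, w]
    · simp [u, hw1]
    · have h1 : ContDiff ℝ 1 (u' a) := by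
        rw [contDiff_one_iff_deriv, hdu']
        exact ⟨fun s ↦ (hu' a s).differentiableAt, (continuous_iccExtend (z a)).const_smul _⟩
      rw [show (2 : ℕ∞ω) = 1 + 1 from rfl, contDiff_succ_iff_deriv, hdu]
      exact ⟨fun s ↦ (hu a s).differentiableAt, by simp, h1⟩
    · simp [hdu, u', primitive]
    · intro s hs
      have h1 := congrArg (fun y : C(I, E) ↦ y ⟨s, hs⟩) ha
      have h2 : z a ⟨s, hs⟩ + Γ (U (a, z a) ⟨s, hs⟩) (U' (a, z a) ⟨s, hs⟩) (U' (a, z a) ⟨s, hs⟩)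
          = 0 := by
        simpa [F, f, superposition, inl, inr] using h1
      rw [hdu, hdu']
      simp only
      rw [huI a ⟨s, hs⟩, huI' a ⟨s, hs⟩, IccExtend_of_mem _ _ hs]
      have h3 := congrArg (fun y ↦ a.2.1 ^ 2 • y) h2
      simpa [smul_smul, pow_two] using h3
  · intro N hN
    obtain ⟨r, hr, hrN⟩ := Metric.mem_nhds_iff.1 hN
    have h1 : ContinuousAt (fun a ↦ U (a, z a)) a₀ :=
      hU.continuous.continuousAt.comp (continuousAt_id.prodMk hz.continuousAt)
    -- At the base parameter the curve is constant, so continuity in the sup norm confines all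
    -- nearby curves to `N` at once.
    have h2 : U (a₀, z a₀) = c x₀ := by simp [U, a₀]
    have h3 : ∀ᶠ a in 𝓝 a₀, U (a, z a) ∈ Metric.ball (c x₀) r := by
      refine h1.eventually (Metric.isOpen_ball.eventually_mem ?_)
      simp only [h2]
      exact Metric.mem_ball_self hr
    filter_upwards [h3] with a ha s hs
    refine hrN ?_
    rw [huI a ⟨s, hs⟩]
    exact (ContinuousMap.dist_apply_le_dist _).trans_lt ha

end

/-! ### Levi-Civita connections on a vector space and the Jacobi field expansion -/

section

open Filter Topology

theorem minSmoothness_two_le_infty : minSmoothness ℝ 2 ≤ ∞ := by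
  rw [minSmoothness_of_isRCLikeNormedField]
  exact WithTop.coe_le_coe.2 le_top

section LineDerivatives

variable {E F F' : Type*} [NormedAddCommGroup E] [NormedSpace ℝ E] [NormedAddCommGroup F]
  [NormedSpace ℝ F] [NormedAddCommGroup F'] [NormedSpace ℝ F']

theorem hasDerivAt_smul_const (a : E) (t : ℝ) : HasDerivAt (fun σ : ℝ ↦ σ • a) a t := by
  simpa using (hasDerivAt_id t).smul_const a

theorem ContDiff.hasFDerivAt_fderiv {f : E → F} (hf : ContDiff ℝ ∞ f) (x : E) :
    HasFDerivAt f (fderiv ℝ f x) x := ((hf.differentiable (by simp)) x).hasFDerivAt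

theorem ContDiff.hasDerivAt_comp_smul {f : E → F} (hf : ContDiff ℝ ∞ f) (X : E) (t : ℝ) :
    HasDerivAt (fun σ : ℝ ↦ f (σ • X)) (fderiv ℝ f (t • X) X) t :=
  (hf.hasFDerivAt_fderiv (t • X)).comp_hasDerivAt t (hasDerivAt_smul_const X t)

theorem HasDerivAt.clm_apply_const {c : ℝ → F →L[ℝ] F'} {c' : F →L[ℝ] F'} {t : ℝ}
    (hc : HasDerivAt c c' t) (a : F) : HasDerivAt (fun σ ↦ c σ a) (c' a) t := by
  simpa using hc.clm_apply (hasDerivAt_const t a)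

/-- The geodesic equation along lines through the origin, differentiated in the direction `Y`. -/
theorem geodesic_variation {Γ : E → E →L[ℝ] E →L[ℝ] E} (hΓ : ContDiff ℝ ∞ Γ)
    {e : E → E} (he : ContDiff ℝ ∞ e) {v : E}
    (hgeo : ∀ᶠ v in 𝓝 v, fderiv ℝ (fderiv ℝ e) v v v
      + Γ (e v) (fderiv ℝ e v v) (fderiv ℝ e v v) = 0) (Y : E) :
    fderiv ℝ (fderiv ℝ (fderiv ℝ e)) v Y v v + (2 : ℝ) • fderiv ℝ (fderiv ℝ e) v v Y
      + (fderiv ℝ Γ (e v) (fderiv ℝ e v Y) (fderiv ℝ e v v) (fderiv ℝ e v v)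
        + Γ (e v) (fderiv ℝ (fderiv ℝ e) v v Y + fderiv ℝ e v Y) (fderiv ℝ e v v)
        + Γ (e v) (fderiv ℝ e v v) (fderiv ℝ (fderiv ℝ e) v v Y + fderiv ℝ e v Y)) = 0 := by
  have hD1 : ContDiff ℝ ∞ (fderiv ℝ e) := he.fderiv_right (by simp)
  have hD2 : ContDiff ℝ ∞ (fderiv ℝ (fderiv ℝ e)) := hD1.fderiv_right (by simp)
  have sym2 : fderiv ℝ (fderiv ℝ e) v Y v = fderiv ℝ (fderiv ℝ e) v v Y :=
    (he.contDiffAt.isSymmSndFDerivAt minSmoothness_two_le_infty).eq Y v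
  have c0 := hasFDerivAt_id (𝕜 := ℝ) v
  have c1 := (hD1.hasFDerivAt_fderiv v).clm_apply c0
  have h1 := (((hD2.hasFDerivAt_fderiv v).clm_apply c0).clm_apply c0).add
    ((((hΓ.hasFDerivAt_fderiv (e v)).comp v (he.hasFDerivAt_fderiv v)).clm_apply c1).clm_apply c1)
  have h2 := congrArg (fun A : E →L[ℝ] E ↦ A Y)
    (h1.unique ((hasFDerivAt_const (0 : E) v).congr_of_eventuallyEq hgeo))
  simp only [add_apply, ContinuousLinearMap.comp_apply, ContinuousLinearMap.flip_apply,
    ContinuousLinearMap.id_apply, Function.comp_apply, id_eq, zero_apply, sym2] at h2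
  rw [← h2]
  simp only [map_add, add_apply]
  module

end LineDerivatives

/-- `Γ` is the Christoffel form of the Levi-Civita connection of the (indefinite) metric `G` on the
open set `s` of a vector space. -/
structure IsLeviCivitaOn {E : Type*} [NormedAddCommGroup E] [NormedSpace ℝ E]
    (G : E → E →L[ℝ] E →L[ℝ] ℝ) (Γ : E → E →L[ℝ] E →L[ℝ] E) (s : Set E) : Prop where
  isOpen : IsOpen s
  contDiffOn_metric : ContDiffOn ℝ ∞ G s
  contDiffOn_christoffel : ContDiffOn ℝ ∞ Γ s
  symm : ∀ x ∈ s, ∀ v w, G x v w = G x w v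
  nondegenerate : ∀ x ∈ s, ∀ v, (∀ w, G x v w = 0) → v = 0
  lower : ∀ x ∈ s, ∀ v w z, G x (Γ x v w) z
    = (1 / 2) * (fderiv ℝ G x v w z + fderiv ℝ G x w v z - fderiv ℝ G x z v w)

/-- The curvature `R(X,Y)Z` of a Christoffel form. -/
noncomputable def curvatureForm {E : Type*} [NormedAddCommGroup E] [NormedSpace ℝ E]
    (Γ : E → E →L[ℝ] E →L[ℝ] E) (x X Y Z : E) : E :=
  fderiv ℝ Γ x X Y Z - fderiv ℝ Γ x Y X Z + Γ x X (Γ x Y Z) - Γ x Y (Γ x X Z)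

namespace IsLeviCivitaOn

variable {E : Type*} [NormedAddCommGroup E] [NormedSpace ℝ E]
  {G : E → E →L[ℝ] E →L[ℝ] ℝ} {Γ : E → E →L[ℝ] E →L[ℝ] E} {s : Set E} {x : E}

theorem contDiffAt_metric (h : IsLeviCivitaOn G Γ s) (hx : x ∈ s) : ContDiffAt ℝ ∞ G x :=
  h.contDiffOn_metric.contDiffAt (h.isOpen.mem_nhds hx)

theorem contDiffAt_christoffel (h : IsLeviCivitaOn G Γ s) (hx : x ∈ s) : ContDiffAt ℝ ∞ Γ x :=
  h.contDiffOn_christoffel.contDiffAt (h.isOpen.mem_nhds hx)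

theorem hasFDerivAt_metric (h : IsLeviCivitaOn G Γ s) (hx : x ∈ s) :
    HasFDerivAt G (fderiv ℝ G x) x :=
  ((h.contDiffAt_metric hx).differentiableAt (by simp)).hasFDerivAt

theorem hasFDerivAt_christoffel (h : IsLeviCivitaOn G Γ s) (hx : x ∈ s) :
    HasFDerivAt Γ (fderiv ℝ Γ x) x :=
  ((h.contDiffAt_christoffel hx).differentiableAt (by simp)).hasFDerivAt

theorem fderiv_symm (h : IsLeviCivitaOn G Γ s) (hx : x ∈ s) (z v w : E) :
    fderiv ℝ G x z v w = fderiv ℝ G x z w v := by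
  have h1 := fun v w : E ↦ ((h.hasFDerivAt_metric hx).clm_apply (hasFDerivAt_const v x)).clm_apply
    (hasFDerivAt_const w x)
  have h2 : (fun y ↦ G y v w) =ᶠ[𝓝 x] fun y ↦ G y w v := by
    filter_upwards [h.isOpen.mem_nhds hx] with y hy using h.symm y hy v w
  simpa using congrArg (fun A : E →L[ℝ] ℝ ↦ A z) (((h1 w v).congr_of_eventuallyEq h2).unique
    (h1 v w)).symm

theorem christoffel_symm (h : IsLeviCivitaOn G Γ s) (hx : x ∈ s) (v w : E) :
    Γ x v w = Γ x w v := by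
  refine sub_eq_zero.1 (h.nondegenerate x hx _ fun z ↦ ?_)
  rw [map_sub, sub_apply, h.lower x hx, h.lower x hx,
    h.fderiv_symm hx z v w]
  ring

/-- In the sum of the two formulas from `lower` the terms that differentiate along `a` and `b`
cancel. -/
theorem compat (h : IsLeviCivitaOn G Γ s) (hx : x ∈ s) (v a b : E) :
    fderiv ℝ G x v a b = G x (Γ x v a) b + G x a (Γ x v b) := by
  rw [h.symm x hx a, h.lower x hx, h.lower x hx, h.fderiv_symm hx v b a, h.fderiv_symm hx b v a]
  ring

set_option maxSynthPendingDepth 2 in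
theorem sndFDeriv_metric (h : IsLeviCivitaOn G Γ s) (hx : x ∈ s) (c d a b : E) :
    fderiv ℝ (fderiv ℝ G) x c d a b = G x (Γ x c (Γ x d a)) b + G x (Γ x d a) (Γ x c b)
      + G x (fderiv ℝ Γ x c d a) b + (G x (Γ x c a) (Γ x d b) + G x a (Γ x c (Γ x d b))
      + G x a (fderiv ℝ Γ x c d b)) := by
  have hG := h.hasFDerivAt_metric hx
  have hΓ := h.hasFDerivAt_christoffel hx
  have hG2 : HasFDerivAt (fderiv ℝ G) (fderiv ℝ (fderiv ℝ G) x) x :=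
    (((h.contDiffAt_metric hx).fderiv_right (m := ∞) (by simp)).differentiableAt
      (by simp)).hasFDerivAt
  have hc := fun y : E ↦ hasFDerivAt_const (𝕜 := ℝ) y x
  have h1 := ((hG2.clm_apply (hc d)).clm_apply (hc a)).clm_apply (hc b)
  have h2 := ((hG.clm_apply ((hΓ.clm_apply (hc d)).clm_apply (hc a))).clm_apply (hc b)).add
    ((hG.clm_apply (hc a)).clm_apply ((hΓ.clm_apply (hc d)).clm_apply (hc b)))
  have h3 : (fun y ↦ fderiv ℝ G y d a b)
      =ᶠ[𝓝 x] fun y ↦ G y (Γ y d a) b + G y a (Γ y d b) := by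
    filter_upwards [h.isOpen.mem_nhds hx] with y hy using h.compat hy d a b
  have h4 := congrArg (fun A : E →L[ℝ] ℝ ↦ A c) (h1.unique (h2.congr_of_eventuallyEq h3))
  simp [h.compat hx] at h4
  linarith

set_option maxSynthPendingDepth 2 in
-- Second derivatives of `G` commute. Once first derivatives are eliminated by compatibility, as in
-- `sndFDeriv_metric`, the difference of the two orders is `G(R(X,Y)a, b) + G(a, R(X,Y)b)`, so this
-- vanishes.
theorem curvatureForm_antisymm (h : IsLeviCivitaOn G Γ s) (hx : x ∈ s) (X Y a b : E) :
    G x (curvatureForm Γ x X Y a) b = -G x a (curvatureForm Γ x X Y b) := by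
  have hs : fderiv ℝ (fderiv ℝ G) x X Y = fderiv ℝ (fderiv ℝ G) x Y X :=
    ((h.contDiffAt_metric hx).isSymmSndFDerivAt minSmoothness_two_le_infty).eq X Y
  have h1 := h.sndFDeriv_metric hx X Y a b
  rw [hs, h.sndFDeriv_metric hx Y X a b] at h1
  simp only [curvatureForm, map_sub, map_add, sub_apply,
    add_apply]
  linarith

set_option maxHeartbeats 1000000 in
/-- The second-order expansion of `G(η, η)` for the rescaled Jacobi field `η(t) = D e(t X) Y` of a
map `e` which sends lines through `0` to geodesics. -/
theorem deriv_deriv_jacobi (h : IsLeviCivitaOn G Γ s) (hG : ContDiff ℝ ∞ G) (hΓ : ContDiff ℝ ∞ Γ)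
    {e : E → E} (he : ContDiff ℝ ∞ e) (he₀ : e 0 = x) (hx : x ∈ s)
    (hde : fderiv ℝ e 0 = ContinuousLinearMap.id ℝ E)
    (hgeo : ∀ᶠ v in 𝓝 (0 : E), fderiv ℝ (fderiv ℝ e) v v v
      + Γ (e v) (fderiv ℝ e v v) (fderiv ℝ e v v) = 0) (X Y : E) :
    let k : ℝ → ℝ := fun t ↦ G (e (t • X)) (fderiv ℝ e (t • X) Y) (fderiv ℝ e (t • X) Y)
    k 0 = G x Y Y ∧ deriv k 0 = 0 ∧
      deriv (deriv k) 0 = 2 / 3 * G x (curvatureForm Γ x X Y X) Y := by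
  intro k
  set D1 := fderiv ℝ e with hD1
  have hD1s : ContDiff ℝ ∞ D1 := he.fderiv_right (by simp)
  set D2 := fderiv ℝ D1 with hD2
  have hD2s : ContDiff ℝ ∞ D2 := hD1s.fderiv_right (by simp)
  set D3 := fderiv ℝ D2 with hD3
  have hD3s : ContDiff ℝ ∞ D3 := hD2s.fderiv_right (by simp)
  have sym2 : ∀ v a b, D2 v a b = D2 v b a := fun v a b ↦
    (he.contDiffAt.isSymmSndFDerivAt minSmoothness_two_le_infty).eq a b
  have sym3 : ∀ v a b, D3 v a b = D3 v b a := fun v a b ↦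
    (hD1s.contDiffAt.isSymmSndFDerivAt minSmoothness_two_le_infty).eq a b
  have sym3' : ∀ v a b c, D3 v a b c = D3 v a c b := by
    intro v a b c
    have h1 := fun b c : E ↦
      ((hD2s.hasFDerivAt_fderiv v).clm_apply (hasFDerivAt_const b v)).clm_apply
      (hasFDerivAt_const c v)
    have h2 : (fun y ↦ D2 y b c) = fun y ↦ D2 y c b := funext fun y ↦ sym2 y b c
    have h3 := congrArg (fun A : E →L[ℝ] E ↦ A a) ((h1 b c).unique (h2 ▸ h1 c b))
    simpa [hD3] using h3
  have hvar : ∀ᶠ v in 𝓝 (0 : E), D3 v Y v v + (2 : ℝ) • D2 v v Y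
      + (fderiv ℝ Γ (e v) (D1 v Y) (D1 v v) (D1 v v)
        + Γ (e v) (D2 v v Y + D1 v Y) (D1 v v) + Γ (e v) (D1 v v) (D2 v v Y + D1 v Y)) = 0 := by
    filter_upwards [hgeo.eventually_nhds] with v hv using geodesic_variation hΓ he hv Y
  set φ : ℝ → E := fun t ↦ e (t • X) with hφ
  set φ' : ℝ → E := fun t ↦ D1 (t • X) X with hφ'
  set η : ℝ → E := fun t ↦ D1 (t • X) Y with hη
  set η' : ℝ → E := fun t ↦ D2 (t • X) X Y with hη'
  set η'' : ℝ → E := fun t ↦ D3 (t • X) X X Y with hη''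
  have dφ : ∀ t, HasDerivAt φ (φ' t) t := fun t ↦ he.hasDerivAt_comp_smul X t
  have dD1 : ∀ t a, HasDerivAt (fun t : ℝ ↦ D1 (t • X) a) (D2 (t • X) X a) t := fun t a ↦
    (hD1s.hasDerivAt_comp_smul X t).clm_apply_const a
  have dD2 : ∀ t a b, HasDerivAt (fun t : ℝ ↦ D2 (t • X) a b) (D3 (t • X) X a b) t :=
    fun t a b ↦ ((hD2s.hasDerivAt_comp_smul X t).clm_apply_const a).clm_apply_const b
  have dΓ : ∀ t, HasDerivAt (fun t ↦ Γ (φ t)) (fderiv ℝ Γ (φ t) (φ' t)) t := fun t ↦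
    (hΓ.hasFDerivAt_fderiv _).comp_hasDerivAt t (dφ t)
  have dGφ : ∀ t, HasDerivAt (fun t ↦ G (φ t)) (fderiv ℝ G (φ t) (φ' t)) t := fun t ↦
    (hG.hasFDerivAt_fderiv _).comp_hasDerivAt t (dφ t)
  -- `ζ` is the covariant derivative of `η` along the geodesic `φ`.
  set ζ : ℝ → E := fun t ↦ η' t + Γ (φ t) (φ' t) (η t) with hζ
  have dζ : ∀ t, HasDerivAt ζ (η'' t + (fderiv ℝ Γ (φ t) (φ' t) (φ' t) (η t)
      + Γ (φ t) (D2 (t • X) X X) (η t) + Γ (φ t) (φ' t) (η' t))) t := fun t ↦ by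
    refine ((dD2 t X Y).add (((dΓ t).clm_apply (dD1 t X)).clm_apply (dD1 t Y))).congr_deriv ?_
    simp [hη'', hη', hη, hφ']
  -- `S` is chosen so that the variation equation at `v = tX`, divided by `t`, reads `2ζ + tS = 0`;
  -- this is the Jacobi equation for `tη`.
  set S : ℝ → E := fun t ↦ η'' t + fderiv ℝ Γ (φ t) (η t) (φ' t) (φ' t)
    + (2 : ℝ) • Γ (φ t) (φ' t) (η' t) with hS
  have hscont : ContDiff ℝ ∞ fun t : ℝ ↦ t • X := contDiff_id.smul contDiff_const
  have sφ : ContDiff ℝ ∞ φ := he.comp hscont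
  have sφ' : ContDiff ℝ ∞ φ' := (hD1s.comp hscont).clm_apply contDiff_const
  have sη : ContDiff ℝ ∞ η := (hD1s.comp hscont).clm_apply contDiff_const
  have sη' : ContDiff ℝ ∞ η' := ((hD2s.comp hscont).clm_apply contDiff_const).clm_apply
    contDiff_const
  have sη'' : ContDiff ℝ ∞ η'' := (((hD3s.comp hscont).clm_apply contDiff_const).clm_apply
    contDiff_const).clm_apply contDiff_const
  have sS : ContDiff ℝ ∞ S := (sη''.add (((((hΓ.fderiv_right (m := ∞) (by simp)).comp sφ).clm_apply
    sη).clm_apply sφ').clm_apply sφ')).add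
    ((((hΓ.comp sφ).clm_apply sφ').clm_apply sη').const_smul (2 : ℝ))
  have tend0 : Tendsto (fun t : ℝ ↦ t • X) (𝓝 0) (𝓝 0) := by
    simpa using (hasDerivAt_smul_const X 0).continuousAt.tendsto
  have hφs : ∀ᶠ t in 𝓝 (0 : ℝ), φ t ∈ s := by
    have h1 : φ 0 = x := by simp [hφ, he₀]
    exact (dφ 0).continuousAt.eventually (h.isOpen.eventually_mem (h1 ▸ hx))
  have hΓs : ∀ᶠ t in 𝓝 (0 : ℝ), ∀ v w, Γ (φ t) v w = Γ (φ t) w v := hφs.mono fun t ht v w ↦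
    h.christoffel_symm ht v w
  have hζS' : ∀ᶠ t in 𝓝[≠] (0 : ℝ), (2 : ℝ) • ζ t + t • S t = 0 := by
    filter_upwards [(tend0.eventually hvar).filter_mono nhdsWithin_le_nhds,
      hΓs.filter_mono nhdsWithin_le_nhds, self_mem_nhdsWithin] with t ht hsymm ht0
    refine smul_right_injective E ht0 ?_
    simp only [smul_zero]
    rw [← ht, sym3 (t • X) Y, hsymm (D2 (t • X) (t • X) Y + D1 (t • X) Y)]
    simp only [map_smul, smul_apply, map_add]
    rw [sym3' (t • X) X Y X]
    simp only [hζ, hS, hη, hη', hη'', hφ, hφ']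
    module
  -- The division by `t` excludes `t = 0`; continuity restores it.
  have hζ0 : ζ 0 = 0 := by
    have hc : Continuous fun t ↦ (2 : ℝ) • ζ t + t • S t :=
      ((continuous_iff_continuousAt.2 fun t ↦ (dζ t).continuousAt).const_smul _).add
        (continuous_id.smul sS.continuous)
    have h1 := tendsto_nhds_unique ((hc.tendsto 0).mono_left nhdsWithin_le_nhds)
      ((tendsto_congr' hζS').2 tendsto_const_nhds)
    simpa using h1
  have hζS : ζ =ᶠ[𝓝 0] fun t ↦ t • ((-(1 / 2) : ℝ) • S t) := by
    have : ∀ᶠ t in 𝓝[≠] (0 : ℝ), ζ t = t • ((-(1 / 2) : ℝ) • S t) := by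
      filter_upwards [hζS'] with t ht
      have h1 : ζ t - t • ((-(1 / 2) : ℝ) • S t) = (1 / 2 : ℝ) • ((2 : ℝ) • ζ t + t • S t) := by
        module
      rw [← sub_eq_zero, h1, ht, smul_zero]
    rw [eventually_nhdsWithin_iff] at this
    filter_upwards [this] with t ht
    by_cases h0 : t = 0
    · simp [h0, hζ0]
    · exact ht h0
  have e1 : φ 0 = x := by simp [hφ, he₀]
  have e2 : φ' 0 = X := by simp [hφ', hde]
  have e3 : η 0 = Y := by simp [hη, hde]
  have hΓx := h.christoffel_symm hx
  have e4 : η' 0 = -Γ x X Y := by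
    have : η' 0 + Γ x X Y = 0 := by simpa [hζ, e1, e2, e3] using hζ0
    exact eq_neg_of_add_eq_zero_left this
  have e5 : D2 ((0 : ℝ) • X) X X = -Γ x X X := by
    have hg : ∀ᶠ t in 𝓝[≠] (0 : ℝ), D2 (t • X) X X + Γ (φ t) (φ' t) (φ' t) = 0 := by
      filter_upwards [(tend0.eventually hgeo).filter_mono nhdsWithin_le_nhds,
        self_mem_nhdsWithin] with t ht ht0
      have ht2 : t ^ 2 ≠ 0 := pow_ne_zero 2 ht0
      refine smul_right_injective E ht2 ?_
      simp only [smul_zero]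
      rw [← ht]
      simp only [map_smul, smul_apply, hφ, hφ']
      module
    have hc : Continuous fun t : ℝ ↦ D2 (t • X) X X + Γ (φ t) (φ' t) (φ' t) :=
      (continuous_iff_continuousAt.2 fun t ↦ (dD2 t X X).continuousAt).add
        (((hΓ.comp sφ).clm_apply sφ').clm_apply sφ').continuous
    have h1 := tendsto_nhds_unique ((hc.tendsto 0).mono_left nhdsWithin_le_nhds)
      ((tendsto_congr' hg).2 tendsto_const_nhds)
    rw [e1, e2] at h1
    exact eq_neg_of_add_eq_zero_left h1
  obtain ⟨ζ', hζ', hζR⟩ : ∃ ζ', HasDerivAt ζ ζ' 0 ∧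
      (3 : ℝ) • ζ' = curvatureForm Γ x X Y X := by
    refine ⟨_, dζ 0, ?_⟩
    have h1 : HasDerivAt (fun t ↦ t • ((-(1 / 2) : ℝ) • S t)) ((-(1 / 2) : ℝ) • S 0) 0 := by
      have h2 := (hasDerivAt_id (0 : ℝ)).smul
        (((sS.differentiable (by simp)) 0).hasDerivAt.const_smul (-(1 / 2) : ℝ))
      refine h2.congr_deriv ?_
      simp
    have h3 := (dζ 0).unique (h1.congr_of_eventuallyEq hζS)
    -- From `ζ = -tS/2` comes `ζ'(0) = -S(0)/2`, hence `3ζ'(0) = ζ'(0) - S(0)`. In this combination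
    -- the unknown third derivative `η''(0)` cancels, and what remains is the curvature.
    have h4 : ∀ A B : E, A = (-(1 / 2) : ℝ) • B → (3 : ℝ) • A = A - B := by
      rintro A B rfl
      module
    rw [h4 _ _ h3]
    simp only [hS, e1, e2, e3, e4, e5, curvatureForm, map_neg, neg_apply, hΓx (Γ x X X) Y, hΓx Y X]
    have h5 : fderiv ℝ Γ x X X Y = fderiv ℝ Γ x X Y X := by
      have h1 := fun b c : E ↦ ((h.hasFDerivAt_christoffel hx).clm_apply
        (hasFDerivAt_const b x)).clm_apply (hasFDerivAt_const c x)
      have h2 : (fun y ↦ Γ y X Y) =ᶠ[𝓝 x] fun y ↦ Γ y Y X := by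
        filter_upwards [h.isOpen.mem_nhds hx] with y hy using h.christoffel_symm hy X Y
      have h3 := congrArg (fun A : E →L[ℝ] E ↦ A X)
        ((h1 X Y).unique ((h1 Y X).congr_of_eventuallyEq h2))
      simpa using h3
    rw [h5]
    module
  have hk : ∀ t, HasDerivAt k (fderiv ℝ G (φ t) (φ' t) (η t) (η t) + G (φ t) (η' t) (η t)
      + G (φ t) (η t) (η' t)) t := fun t ↦ by
    refine (((dGφ t).clm_apply (dD1 t Y)).clm_apply (dD1 t Y)).congr_deriv ?_
    simp [hη, hη']
  -- Compatibility turns `k'` into `2G(ζ, η)`. As `ζ(0) = 0`, only `2G(ζ'(0), Y)` survives in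
  -- `k''(0)`.
  have hk' : deriv k =ᶠ[𝓝 0] fun t ↦ 2 * G (φ t) (ζ t) (η t) := by
    filter_upwards [hφs] with t ht
    rw [(hk t).deriv, h.compat ht, h.symm _ ht (η t), h.symm _ ht (η t)]
    simp only [hζ, map_add, add_apply]
    ring
  refine ⟨by simp [k, he₀, hde, ← hD1], ?_, ?_⟩
  · rw [hk'.self_of_nhds]
    simp [hζ0]
  · rw [hk'.deriv_eq]
    have h1 := (((dGφ 0).clm_apply hζ').clm_apply (dD1 0 Y)).const_mul 2
    rw [HasDerivAt.deriv (f' := 2 * G x ζ' Y)]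
    · rw [← hζR]
      simp only [map_smul, smul_apply, smul_eq_mul]
      ring
    · refine h1.congr_deriv ?_
      simp only [hζ0, e1]
      have e3' : D1 ((0 : ℝ) • X) Y = Y := e3
      rw [e3']
      simp

end IsLeviCivitaOn

end

/-! ### The length of short geodesic triangles in coordinates -/

section

open Filter Topology

theorem curvatureForm_congr {E : Type*} [NormedAddCommGroup E] [NormedSpace ℝ E]
    {Γ Γ' : E → E →L[ℝ] E →L[ℝ] E} {x : E} (h : Γ' =ᶠ[𝓝 x] Γ) :
    curvatureForm Γ' x = curvatureForm Γ x := by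
  funext X Y Z
  simp only [curvatureForm, h.fderiv_eq, h.self_of_nhds]

/-- Hadamard's lemma and the superposition operators are available for globally smooth maps, while
only the germs at `x` matter; cut-offs supply the extensions, and `s'` is where nothing has changed.
-/
theorem IsLeviCivitaOn.exists_global {E : Type*} [NormedAddCommGroup E] [NormedSpace ℝ E]
    [FiniteDimensional ℝ E] {G : E → E →L[ℝ] E →L[ℝ] ℝ} {Γ : E → E →L[ℝ] E →L[ℝ] E} {s : Set E}
    {x : E} (h : IsLeviCivitaOn G Γ s) (hx : x ∈ s) :
    ∃ G' Γ', ContDiff ℝ ∞ G' ∧ ContDiff ℝ ∞ Γ' ∧ ∃ s', x ∈ s' ∧ IsLeviCivitaOn G' Γ' s' ∧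
      EqOn G' G s' ∧ EqOn Γ' Γ s' := by
  obtain ⟨G', hG', hGG⟩ :=
    h.contDiffOn_metric.exists_contDiff_eventuallyEq (h.isOpen.mem_nhds hx)
  obtain ⟨Γ', hΓ', hΓΓ⟩ :=
    h.contDiffOn_christoffel.exists_contDiff_eventuallyEq (h.isOpen.mem_nhds hx)
  obtain ⟨s', hs', hso, hxs⟩ := eventually_nhds_iff.1
    (hGG.and (hΓΓ.and (h.isOpen.eventually_mem hx)))
  have hf : ∀ y ∈ s', fderiv ℝ G' y = fderiv ℝ G y := fun y hy ↦
    EventuallyEq.fderiv_eq (by filter_upwards [hso.mem_nhds hy] with z hz using (hs' z hz).1)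
  refine ⟨G', Γ', hG', hΓ', s', hxs, ⟨hso, hG'.contDiffOn, hΓ'.contDiffOn, ?_, ?_, ?_⟩,
    fun y hy ↦ (hs' y hy).1, fun y hy ↦ (hs' y hy).2.1⟩
  · intro y hy v w
    rw [(hs' y hy).1, h.symm y (hs' y hy).2.2]
  · intro y hy v hv
    rw [(hs' y hy).1] at hv
    exact h.nondegenerate y (hs' y hy).2.2 v hv
  · intro y hy v w z
    rw [hf y hy, (hs' y hy).1, (hs' y hy).2.1]
    exact h.lower y (hs' y hy).2.2 v w z

theorem deriv_deriv_of_sq_eventuallyEq {σ k : ℝ → ℝ} (hσ : ContDiff ℝ 2 σ)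
    (hk : (fun t ↦ σ t ^ 2) =ᶠ[𝓝 0] fun t ↦ -k t) (h0 : σ 0 = 1) (h1 : deriv k 0 = 0) :
    deriv σ 0 = 0 ∧ deriv (deriv σ) 0 = -(deriv (deriv k) 0) / 2 := by
  have d0 : ∀ t, HasDerivAt σ (deriv σ t) t := fun t ↦
    ((hσ.differentiable (by simp)) t).hasDerivAt
  have hσ' : ContDiff ℝ 1 (deriv σ) := hσ.deriv'
  have d1 : HasDerivAt (deriv σ) (deriv (deriv σ) 0) 0 :=
    ((hσ'.differentiable (by simp)) 0).hasDerivAt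
  have hsq : ∀ t, HasDerivAt (fun t ↦ σ t ^ 2) (2 * σ t * deriv σ t) t := fun t ↦ by
    refine ((d0 t).pow 2).congr_deriv ?_
    simp
  have e1 : (fun t ↦ 2 * σ t * deriv σ t) =ᶠ[𝓝 0] fun t ↦ -deriv k t := by
    have := hk.deriv
    rwa [show deriv (fun t ↦ σ t ^ 2) = fun t ↦ 2 * σ t * deriv σ t from
      funext fun t ↦ (hsq t).deriv, show deriv (fun t ↦ -k t) = fun t ↦ -deriv k t from
      deriv.neg'] at this
  have hz : deriv σ 0 = 0 := by
    have := e1.self_of_nhds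
    simpa [h0, h1] using this
  refine ⟨hz, ?_⟩
  have e2 := (((d0 0).const_mul 2).mul d1).deriv
  have e3 := e1.deriv_eq
  rw [show deriv (fun t ↦ -deriv k t) 0 = -deriv (deriv k) 0 from deriv.neg] at e3
  have e4 : deriv (fun t ↦ 2 * σ t * deriv σ t) 0 = 2 * deriv (deriv σ) 0 := by
    rw [show (fun t ↦ 2 * σ t * deriv σ t) = (fun t ↦ 2 * σ t) * deriv σ from rfl, e2]
    simp [h0, hz]
  rw [e4] at e3
  linarith

/-- The length function of short geodesic triangles with vertex `e 0`, in coordinates. -/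
theorem IsLeviCivitaOn.exists_length {E : Type} [NormedAddCommGroup E] [NormedSpace ℝ E]
    [FiniteDimensional ℝ E] {G : E → E →L[ℝ] E →L[ℝ] ℝ} {Γ : E → E →L[ℝ] E →L[ℝ] E} {s : Set E}
    {x : E} (h : IsLeviCivitaOn G Γ s) (hx : x ∈ s) {e : E → E} {V : Set E}
    (he : ContDiffOn ℝ ∞ e V) (hV : V ∈ 𝓝 0) (he₀ : e 0 = x)
    (hde : fderiv ℝ e 0 = ContinuousLinearMap.id ℝ E)
    (hgeo : ∀ᶠ v in 𝓝 (0 : E), fderiv ℝ (fderiv ℝ e) v v v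
      + Γ (e v) (fderiv ℝ e v v) (fderiv ℝ e v v) = 0) (X Y : E) (hY : G x Y Y = -1) :
    ∃ S : ℝ × ℝ → ℝ, ContDiff ℝ 6 S ∧ S 0 = 1 ∧ deriv (fun t ↦ S (t, 0)) 0 = 0 ∧
      deriv (deriv fun t ↦ S (t, 0)) 0 = -(G x (curvatureForm Γ x X Y X) Y) / 3 ∧
      ∀ N ∈ 𝓝 x, ∀ᶠ z in 𝓝 (0 : ℝ × ℝ), ∃ u : ℝ → E, ContDiff ℝ 2 u ∧ u 0 = e (z.1 • X) ∧
        u 1 = e (z.1 • (Real.cos z.2 • X + Real.sin z.2 • Y)) ∧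
        (∀ τ ∈ Icc (0 : ℝ) 1, u τ ∈ N ∧
          deriv (deriv u) τ + Γ (u τ) (deriv u τ) (deriv u τ) = 0) ∧
        √|G (u 0) (deriv u 0) (deriv u 0)| = |z.1 * z.2| * S z := by
  have : CompleteSpace E := FiniteDimensional.complete ℝ E
  obtain ⟨e', he', hee⟩ := he.exists_contDiff_eventuallyEq hV
  obtain ⟨G', Γ', hG', hΓ', s', hxs, h', hGG, hΓΓ⟩ := h.exists_global hx
  have hs' : s' ∈ 𝓝 x := h'.isOpen.mem_nhds hxs
  have he₀' : e' 0 = x := by rw [hee.self_of_nhds, he₀]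
  have hde' : fderiv ℝ e' 0 = ContinuousLinearMap.id ℝ E := by rw [hee.fderiv_eq, hde]
  have hgeo' : ∀ᶠ v in 𝓝 (0 : E), fderiv ℝ (fderiv ℝ e') v v v
      + Γ' (e' v) (fderiv ℝ e' v v) (fderiv ℝ e' v v) = 0 := by
    have h1 : ∀ᶠ v in 𝓝 (0 : E), e' v ∈ s' :=
      he'.continuous.continuousAt.eventually (h'.isOpen.eventually_mem (he₀' ▸ hxs))
    filter_upwards [hgeo, hee, hee.fderiv (𝕜 := ℝ), (hee.fderiv (𝕜 := ℝ)).fderiv (𝕜 := ℝ), h1]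
      with v g1 g2 g3 g4 g5
    rw [g4, g3, hΓΓ g5, g2, g1]
  have hGx : G' x = G x := hGG hxs
  obtain ⟨k0, k1, k2⟩ := h'.deriv_deriv_jacobi hG' hΓ' he' he₀' hxs hde' hgeo' X Y
  set k : ℝ → ℝ := fun t ↦ G' (e' (t • X)) (fderiv ℝ e' (t • X) Y) (fderiv ℝ e' (t • X) Y) with hk
  rw [hGx, curvatureForm_congr (hΓΓ.eventuallyEq_of_mem hs')] at k2
  rw [hGx, hY] at k0
  -- the direction `X(w) = X + w ρ(w)`
  let c : ℝ → E := fun w ↦ Real.cos w • X + Real.sin w • Y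
  have hc : ContDiff ℝ ∞ c := (Real.contDiff_cos.smul contDiff_const).add
    (Real.contDiff_sin.smul contDiff_const)
  obtain ⟨B, hB, hB0, hBc⟩ := hc.exists_hadamard
  let ρ : ℝ → E := fun w ↦ B (0, w) 1
  have hρ : ContDiff ℝ ∞ ρ :=
    (hB.comp (contDiff_const.prodMk contDiff_id)).clm_apply contDiff_const
  have hρ0 : ρ 0 = Y := by
    have h1 : HasDerivAt c Y 0 := by
      have := ((Real.hasDerivAt_cos 0).smul_const X).add ((Real.hasDerivAt_sin 0).smul_const Y)
      refine this.congr_deriv ?_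
      simp
    simp only [ρ, hB0]
    exact h1.deriv
  have hcρ : ∀ w, c w = X + w • ρ w := by
    intro w
    have h1 := hBc 0 w
    rw [zero_add, sub_eq_iff_eq_add'] at h1
    rw [h1, ← map_smul, smul_eq_mul, mul_one]
    simp [c]
  obtain ⟨A, hA, hA0, hAe⟩ := he'.exists_hadamard
  -- The difference quotient of `e'` between `tX` and `tX(w)`, divided by `tw`; Hadamard's lemma
  -- makes it smooth also where `tw = 0`.
  let ψ : ℝ × ℝ → E := fun z ↦ A (z.1 • X, (z.1 * z.2) • ρ z.2) (ρ z.2)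
  have hψ : ContDiff ℝ ∞ ψ := by
    have h1 : ContDiff ℝ ∞ fun z : ℝ × ℝ ↦ ρ z.2 := hρ.comp contDiff_snd
    exact (hA.comp ((contDiff_fst.smul contDiff_const).prodMk
      ((contDiff_fst.mul contDiff_snd).smul h1))).clm_apply h1
  have hψe : ∀ z : ℝ × ℝ, e' (z.1 • c z.2) = e' (z.1 • X) + (z.1 * z.2) • ψ z := by
    intro z
    have h1 := hAe (z.1 • X) ((z.1 * z.2) • ρ z.2)
    rw [sub_eq_iff_eq_add'] at h1
    rw [hcρ, smul_add, smul_smul, h1, map_smul]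
  have hψ0 : ∀ t, ψ (t, 0) = fderiv ℝ e' (t • X) Y := by
    intro t
    simp [ψ, hA0, hρ0]
  let a : ℝ × ℝ → E × ℝ × E := fun z ↦ (e' (z.1 • X), z.1 * z.2, ψ z)
  have hsmul : ContDiff ℝ ∞ fun z : ℝ × ℝ ↦ z.1 • X := contDiff_fst.smul contDiff_const
  have ha : ContDiff ℝ ∞ a :=
    (he'.comp hsmul).prodMk ((contDiff_fst.mul contDiff_snd).prodMk hψ)
  have ha0 : a 0 = (x, 0, Y) := by
    have := hψ0 0
    rw [← Prod.zero_eq_mk] at this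
    simp [a, he₀', this, hde']
  obtain ⟨v, u, hv, hu, huN⟩ := exists_geodesic_family hΓ' x Y 6 (by norm_num)
  rw [← ha0] at hv hu huN
  have hat := ha.continuous.tendsto 0
  -- The geodesic with parameters `a z` has initial velocity `tw(ψ + tw v)`, so its squared speed is
  -- `-(tw)² H`. The sign makes `H` positive near `0`, the separation being spacelike like `Y`.
  let H : ℝ × ℝ → ℝ := fun z ↦ -G' (e' (z.1 • X)) (ψ z + (z.1 * z.2) • v (a z))
    (ψ z + (z.1 * z.2) • v (a z))
  have hH : ContDiffAt ℝ 6 H 0 := by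
    have h6 : ∀ {F : Type} [NormedAddCommGroup F] [NormedSpace ℝ F] {f : ℝ × ℝ → F},
        ContDiff ℝ ∞ f → ContDiffAt ℝ 6 f 0 := fun hf ↦ (contDiff_infty.1 hf 6).contDiffAt
    have h1 : ContDiffAt ℝ 6 (fun z : ℝ × ℝ ↦ ψ z + (z.1 * z.2) • v (a z)) 0 :=
      (h6 hψ).add ((h6 (contDiff_fst.mul contDiff_snd)).smul (hv.comp 0 (h6 ha)))
    exact (((h6 (hG'.comp (he'.comp hsmul))).clm_apply h1).clm_apply h1).neg
  have hHt : ∀ t, H (t, 0) = -k t := by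
    intro t
    simp [H, hψ0, hk]
  have hH0 : H 0 = 1 := by
    rw [Prod.zero_eq_mk, hHt, k0, neg_neg]
  have hsqrt : ContDiffAt ℝ 6 (fun z ↦ √(H z)) 0 := hH.sqrt (by rw [hH0]; exact one_ne_zero)
  obtain ⟨W, hW, hWs⟩ := hsqrt.contDiffOn (m := 6) le_rfl (by simp)
  -- `S` is a global `C⁶` extension of the germ of `√H`.
  obtain ⟨S, hS, hSH⟩ := ContDiffOn.exists_contDiff_eventuallyEq (n := 6) hWs hW
  have hS0 : S 0 = 1 := by
    rw [hSH.self_of_nhds]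
    simp [hH0]
  have hSt : ContDiff ℝ 2 fun t : ℝ ↦ S (t, 0) :=
    (hS.comp (contDiff_prodMk_left 0)).of_le (by norm_cast)
  have hHpos : ∀ᶠ z in 𝓝 (0 : ℝ × ℝ), 0 < H z :=
    hH.continuousAt.eventually (lt_mem_nhds (by rw [hH0]; exact one_pos))
  have hSk : (fun t ↦ S (t, 0) ^ 2) =ᶠ[𝓝 0] fun t ↦ -k t := by
    have h1 : Tendsto (fun t : ℝ ↦ (t, (0 : ℝ))) (𝓝 0) (𝓝 0) :=
      (Continuous.prodMk_left (0 : ℝ)).tendsto 0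
    filter_upwards [h1.eventually hSH, h1.eventually hHpos] with t h2 h3
    rw [h2, Real.sq_sqrt h3.le, hHt]
  obtain ⟨S1, S2⟩ := deriv_deriv_of_sq_eventuallyEq hSt hSk hS0 k1
  refine ⟨S, hS, hS0, S1, ?_, fun N hN ↦ ?_⟩
  · rw [S2, k2]
    ring
  have he1 : Tendsto (fun z : ℝ × ℝ ↦ z.1 • X) (𝓝 0) (𝓝 0) := by
    simpa using hsmul.continuous.tendsto (0 : ℝ × ℝ)
  have he2 : Tendsto (fun z : ℝ × ℝ ↦ z.1 • c z.2) (𝓝 0) (𝓝 0) := by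
    have h1 : Continuous fun z : ℝ × ℝ ↦ z.1 • c z.2 :=
      continuous_fst.smul (hc.continuous.comp continuous_snd)
    simpa using h1.tendsto (0 : ℝ × ℝ)
  filter_upwards [hat.eventually hu, hat.eventually (huN _ (inter_mem hN hs')),
    he1.eventually hee, he2.eventually hee, hSH, hHpos] with z z1 z2 z3 z4 z5 z6
  obtain ⟨u0, u1, u2, u3, u4⟩ := z1
  refine ⟨u (a z), u2, by rw [u0, ← z3], ?_, fun τ hτ ↦ ⟨(z2 τ hτ).1, ?_⟩, ?_⟩
  · rw [u1, ← z4, hψe]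
  · rw [← hΓΓ (z2 τ hτ).2]
    exact u4 τ hτ
  · have h1 : G' (a z).1 ((a z).2.1 • ((a z).2.2 + (a z).2.1 • v (a z)))
        ((a z).2.1 • ((a z).2.2 + (a z).2.1 • v (a z))) = -((z.1 * z.2) ^ 2 * H z) := by
      simp only [map_smul, smul_apply, smul_eq_mul, H, a]
      ring
    rw [← hGG (z2 0 ⟨le_rfl, zero_le_one⟩).2, u3, u0, z5, h1, abs_neg,
      abs_of_nonneg (by positivity), Real.sqrt_mul (sq_nonneg _), Real.sqrt_sq_eq_abs]

end

/-! ### Taylor expansion and mixed derivatives of the length -/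

section

open Filter Topology

theorem ContDiff.id_mul {n : ℕ∞ω} {h : ℝ → ℝ} (hh : ContDiff ℝ n h) :
    ContDiff ℝ n fun t ↦ t * h t := contDiff_id.mul hh

/-- In Leibniz' formula at `0` only the term with the first derivative of `t` survives, with
binomial factor `n + 1`. -/
theorem iteratedDeriv_id_mul_zero {n : ℕ} {h : ℝ → ℝ} (hh : ContDiff ℝ (n + 1 : ℕ) h) :
    iteratedDeriv (n + 1) (fun t ↦ t * h t) 0 = (n + 1) * iteratedDeriv n h 0 := by
  have h1 : iteratedDeriv (n + 1) ((fun t : ℝ ↦ t) * h) 0 = _ :=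
    iteratedDeriv_mul contDiff_id.contDiffAt hh.contDiffAt
  change iteratedDeriv (n + 1) ((fun t : ℝ ↦ t) * h) 0 = _
  rw [h1, Finset.sum_eq_single 1]
  · simp [iteratedDeriv_one]
  · rintro (_ | _ | i) _ hi
    · simp
    · simp at hi
    · have : deriv (fun t : ℝ ↦ t) = fun _ ↦ 1 := deriv_id''
      rw [iteratedDeriv_succ', this, iteratedDeriv_const]
      simp
  · simp

theorem iteratedDerivWithin_Ici_zero {n : ℕ} {f : ℝ → ℝ} (hf : ContDiff ℝ n f) :
    iteratedDerivWithin n f (Ici 0) 0 = iteratedDeriv n f 0 :=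
  iteratedDerivWithin_eq_iteratedDeriv (uniqueDiffOn_Ici 0) hf.contDiffAt self_mem_Ici

theorem exists_cubic_remainder {σ : ℝ → ℝ} (hσ : ContDiff ℝ 3 σ) :
    ∃ C, ∀ t ∈ Icc (0 : ℝ) 1,
      |σ t - (σ 0 + t * deriv σ 0 + t ^ 2 / 2 * deriv (deriv σ) 0)| ≤ C * t ^ 3 := by
  obtain ⟨C, hC⟩ := exists_taylor_mean_remainder_bound (f := σ) (n := 2) (zero_le_one (α := ℝ))
    (hσ.contDiffOn.of_le (by norm_num))
  refine ⟨C, fun t ht ↦ ?_⟩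
  have h1 := hC t ht
  have h2 : ∀ k : ℕ, k ≤ 3 → iteratedDerivWithin k σ (Icc 0 1) 0 = iteratedDeriv k σ 0 :=
    fun k hk ↦ iteratedDerivWithin_eq_iteratedDeriv (uniqueDiffOn_Icc zero_lt_one)
      ((hσ.of_le (by exact_mod_cast hk)).contDiffAt) ⟨le_rfl, zero_le_one⟩
  rw [taylorWithinEval_succ, taylorWithinEval_succ, taylor_within_zero_eval, h2 _ (by norm_num),
    h2 _ (by norm_num), iteratedDeriv_succ (n := 1), iteratedDeriv_one, Real.norm_eq_abs] at h1
  convert h1 using 2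
  · congr 1
    norm_num
    left
    ring
  · simp

/-- The expansion and the derivatives of `L = t w S(t, w)`. -/
theorem length_expansion {S : ℝ × ℝ → ℝ} (hS : ContDiff ℝ 6 S) {K : ℝ} (h0 : S 0 = 1)
    (h1 : deriv (fun t ↦ S (t, 0)) 0 = 0) (h2 : deriv (deriv fun t ↦ S (t, 0)) 0 = -K / 3) :
    (∃ C, ∀ t ∈ Icc (0 : ℝ) 1, ∀ w ∈ Icc (0 : ℝ) 1, ∃ r₁ r₂ : ℝ, |r₁| ≤ C * t ^ 3 ∧ |r₂| ≤ C * w ∧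
      t * w * S (t, w) = t * w * (1 - t ^ 2 / 6 * K + r₁ + r₂)) ∧
    ContDiff ℝ 6 (fun z : ℝ × ℝ ↦ z.1 * z.2 * S z) ∧
    K = -iteratedDerivWithin 3
      (fun t ↦ derivWithin (fun w ↦ t * w * S (t, w)) (Ici 0) 0) (Ici 0) 0 ∧
    K = -(1 / 16) * iteratedDerivWithin 4
      (fun t ↦ iteratedDerivWithin 2 (fun w ↦ (t * w * S (t, w)) ^ 2) (Ici 0) 0) (Ici 0) 0 := by
  set σ : ℝ → ℝ := fun t ↦ S (t, 0) with hσdef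
  have hσ : ContDiff ℝ 6 σ := hS.comp (contDiff_prodMk_left 0)
  have hσ0 : σ 0 = 1 := h0
  have hSw : ∀ t, ContDiff ℝ 6 fun w ↦ S (t, w) := fun t ↦ hS.comp (contDiff_prodMk_right t)
  refine ⟨?_, (contDiff_fst.mul contDiff_snd).mul hS, ?_, ?_⟩
  · obtain ⟨C₁, hC₁⟩ := exists_cubic_remainder (hσ.of_le (by norm_cast))
    -- The derivative of `S` is bounded on the compact convex unit square, so `S(t,w) - S(t,0)` is
    -- `O(w)` uniformly in `t`. The other remainder depends on `t` alone.
    have hconv : Convex ℝ (Icc (0 : ℝ) 1 ×ˢ Icc (0 : ℝ) 1) := (convex_Icc 0 1).prod (convex_Icc 0 1)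
    obtain ⟨C₂, hC₂⟩ := (isCompact_Icc.prod isCompact_Icc).exists_bound_of_continuousOn
      (s := Icc (0 : ℝ) 1 ×ˢ Icc (0 : ℝ) 1) (hS.continuous_fderiv (by simp)).continuousOn
    refine ⟨max C₁ C₂, fun t ht w hw ↦
      ⟨σ t - (1 + t ^ 2 / 2 * (-K / 3)), S (t, w) - S (t, 0), ?_, ?_, ?_⟩⟩
    · have := hC₁ t ht
      rw [h1, h2, hσ0, mul_zero, add_zero] at this
      exact this.trans (mul_le_mul_of_nonneg_right (le_max_left _ _) (pow_nonneg ht.1 3))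
    · have := hconv.norm_image_sub_le_of_norm_fderiv_le
        (fun z _ ↦ (hS.differentiable (by simp)) z) hC₂ (x := (t, 0)) (y := (t, w))
        ⟨ht, le_rfl, zero_le_one⟩ ⟨ht, hw⟩
      have h3 : ‖((t, w) : ℝ × ℝ) - (t, 0)‖ = w := by
        simp [abs_of_nonneg hw.1, hw.1]
      rw [h3] at this
      exact this.trans (mul_le_mul_of_nonneg_right (le_max_right _ _) hw.1)
    · simp only [hσdef]
      ring
  -- The `w`-derivative at `0` is `tσ(t)`, and its third derivative at `0` is `3σ''(0) = -K`.
  · have h3 : (fun t ↦ derivWithin (fun w ↦ t * w * S (t, w)) (Ici 0) 0) = fun t ↦ t * σ t := by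
      funext t
      have hd : HasDerivAt (fun w ↦ t * w * S (t, w)) (t * σ t) 0 := by
        have hs := (((hSw t).differentiable (by simp)) 0).hasDerivAt
        refine (((hasDerivAt_id (0 : ℝ)).const_mul t).mul hs).congr_deriv ?_
        simp [hσdef]
      exact hd.hasDerivWithinAt.derivWithin (uniqueDiffOn_Ici 0 0 self_mem_Ici)
    rw [h3, iteratedDerivWithin_Ici_zero (hσ.id_mul.of_le (by norm_cast)),
      iteratedDeriv_id_mul_zero (hσ.of_le (by norm_cast)), iteratedDeriv_succ, iteratedDeriv_one,
      h2]
    push_cast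
    ring
  -- The second `w`-derivative of `L²` at `0` is `2t²σ²`. Its fourth derivative at `0` is `4 · 3 ·
  -- (2σ²)''(0) = 12 · (-4K/3) = -16K`.
  · have h3 : (fun t ↦ iteratedDerivWithin 2 (fun w ↦ (t * w * S (t, w)) ^ 2) (Ici 0) 0)
        = fun t ↦ t * (t * (2 * σ t ^ 2)) := by
      funext t
      have e : (fun w ↦ (t * w * S (t, w)) ^ 2) = fun w ↦ w * (w * (t * S (t, w)) ^ 2) := by
        funext w
        ring
      have hc : ContDiff ℝ 6 fun w ↦ (t * S (t, w)) ^ 2 := (contDiff_const.mul (hSw t)).pow 2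
      rw [e, iteratedDerivWithin_Ici_zero (hc.id_mul.id_mul.of_le
        (by norm_cast)), iteratedDeriv_id_mul_zero (hc.id_mul.of_le (by norm_cast)),
        iteratedDeriv_id_mul_zero (hc.of_le (by norm_cast))]
      simp [hσdef]
      ring
    have hc : ContDiff ℝ 6 fun t ↦ 2 * σ t ^ 2 := contDiff_const.mul (hσ.pow 2)
    have hd : ∀ t, HasDerivAt σ (deriv σ t) t := fun t ↦
      ((hσ.differentiable (by simp)) t).hasDerivAt
    have hd2 : HasDerivAt (deriv σ) (-K / 3) 0 := by
      rw [← h2]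
      exact (((hσ.of_le (m := 1 + 1) (by norm_cast)).deriv'.differentiable (by simp)) 0).hasDerivAt
    have h4 : deriv (fun t ↦ 2 * σ t ^ 2) = fun t ↦ 2 * (2 * σ t * deriv σ t) := by
      funext t
      refine HasDerivAt.deriv ((((hd t).pow 2).const_mul 2).congr_deriv ?_)
      simp
    have h5 : iteratedDeriv 2 (fun t ↦ 2 * σ t ^ 2) 0 = -4 * K / 3 := by
      rw [iteratedDeriv_succ, iteratedDeriv_one, h4]
      refine HasDerivAt.deriv (((((hd 0).const_mul 2).mul hd2).const_mul 2).congr_deriv ?_)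
      rw [h1, hσ0]
      ring
    rw [h3, iteratedDerivWithin_Ici_zero (hc.id_mul.id_mul.of_le
      (by norm_cast)), iteratedDeriv_id_mul_zero (hc.id_mul.of_le (by norm_cast)),
      iteratedDeriv_id_mul_zero (hc.of_le (by norm_cast)), h5]
    push_cast
    ring

end

/-! ### Metric, Christoffel symbols and curvature in a chart -/

section

open Filter Topology

variable {M : Type*} [TopologicalSpace M] [ChartedSpace R4 M] [IsManifold (𝓡 4) ∞ M]
namespace LorentzMetric
variable (g : LorentzMetric M)

/-- The differential of the inverse of the preferred chart at `p`. -/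
noncomputable def frame (p : M) (x : R4) :
    R4 →L[ℝ] TangentSpace (𝓡 4) ((extChartAt (𝓡 4) p).symm x) :=
  mfderiv 𝓘(ℝ, R4) (𝓡 4) (extChartAt (𝓡 4) p).symm x

theorem isInvertible_frame (p : M) {x : R4} (hx : x ∈ (extChartAt (𝓡 4) p).target) :
    (frame p x).IsInvertible := by
  have : IsManifold (𝓡 4) 1 M := .of_le (n := ∞) (by simp)
  have h := isInvertible_mfderivWithin_extChartAt_symm (I := 𝓡 4) hx
  rw [ModelWithCorners.range_eq_univ, mfderivWithin_univ] at h
  exact h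

theorem val_nondegenerate (y : M) (v : TangentSpace (𝓡 4) y) (h : ∀ w, g.val y v w = 0) :
    v = 0 := by
  obtain ⟨b, hb⟩ := g.signature y
  refine b.repr.map_eq_zero_iff.1 (Finsupp.ext fun j ↦ ?_)
  have h1 := h (b j)
  rw [← b.sum_repr v, map_sum, sum_apply, Finset.sum_eq_single j] at h1
  · simp only [map_smul, smul_apply, hb, smul_eq_mul, minkowskiEta, if_true] at h1
    split_ifs at h1 <;> simpa using h1
  · intro i _ hij
    simp [hb, minkowskiEta, hij]
  · simp

theorem comp_eq_val (p : M) (x : R4) (i j : Fin 4) : g.comp p x i j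
    = g.val ((extChartAt (𝓡 4) p).symm x) (frame p x (EuclideanSpace.single i 1))
      (frame p x (EuclideanSpace.single j 1)) := rfl

theorem sum_single (v : R4) : v = ∑ i, v i • (EuclideanSpace.single i (1 : ℝ) : R4) := by
  ext j
  simp [Pi.single_apply]

/-- `frame p x v` is the tangent map of the inverse chart applied to a constant vector field, hence
a smooth field along the inverse chart; `g` is a smooth section of the bundle of bilinear forms, and
pairing preserves smoothness. -/
theorem contDiffOn_val_frame (p : M) (v w : R4) :
    ContDiffOn ℝ ∞ (fun x ↦ g.val ((extChartAt (𝓡 4) p).symm x) (frame p x v) (frame p x w))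
      (extChartAt (𝓡 4) p).target := by
  have hopen := isOpen_extChartAt_target (I := 𝓡 4) p
  have hsymm := contMDiffOn_extChartAt_symm (I := 𝓡 4) (n := ∞) p
  have hvec : ∀ v : R4, ContMDiffOn 𝓘(ℝ, R4) ((𝓡 4).prod 𝓘(ℝ, R4)) ∞
      (fun x ↦ Bundle.TotalSpace.mk' R4 (E := fun y : M ↦ TangentSpace (𝓡 4) y)
        ((extChartAt (𝓡 4) p).symm x) (frame p x v))
      (extChartAt (𝓡 4) p).target := by
    intro v
    have h1 := hsymm.contMDiffOn_tangentMapWithin (m := ∞) (by simp) hopen.uniqueMDiffOn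
    have h2 : ContMDiff 𝓘(ℝ, R4) (𝓘(ℝ, R4).prod 𝓘(ℝ, R4)) ∞
        (fun x : R4 ↦ (⟨x, v⟩ : TangentBundle 𝓘(ℝ, R4) R4)) :=
      contMDiff_vectorSpace_iff_contDiff.2 contDiff_const
    refine (h1.comp h2.contMDiffOn (fun x hx ↦ hx)).congr fun x hx ↦ ?_
    simp only [tangentMapWithin, Function.comp_apply]
    rw [mfderivWithin_of_isOpen hopen hx]
    rfl
  intro x hx
  have h3 : ContMDiffWithinAt 𝓘(ℝ, R4) ((𝓡 4).prod 𝓘(ℝ)) ∞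
      (fun x ↦ Bundle.TotalSpace.mk' ℝ (E := Bundle.Trivial M ℝ) ((extChartAt (𝓡 4) p).symm x)
        (g.val ((extChartAt (𝓡 4) p).symm x) (frame p x v) (frame p x w)))
      (extChartAt (𝓡 4) p).target x := by
    apply ContMDiffWithinAt.clm_bundle_apply₂ (F₁ := R4) (F₂ := R4)
    · exact g.contMDiff.contMDiffAt.comp_contMDiffWithinAt x (hsymm x hx)
    · exact hvec v x hx
    · exact hvec w x hx
  simp only [Bundle.contMDiffWithinAt_totalSpace] at h3
  exact h3.2.contDiffWithinAt

/-- An induction principle: identities linear in a vector need checking only on the coordinate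
vectors. -/
theorem forall_of_single {P : R4 → Prop} (hs : ∀ i, P (EuclideanSpace.single i 1))
    (ha : ∀ v w, P v → P w → P (v + w)) (hm : ∀ (c : ℝ) v, P v → P (c • v)) (v : R4) : P v := by
  rw [sum_single v]
  refine Finset.sum_induction_nonempty _ P ha Finset.univ_nonempty fun i _ ↦ hm _ _ (hs i)

/-- The metric in the preferred chart at `p`, as a bilinear form. -/
noncomputable def form (p : M) (x : R4) : R4 →L[ℝ] R4 →L[ℝ] ℝ :=
  ∑ i, ∑ j, g.comp p x i j •
    (EuclideanSpace.proj (𝕜 := ℝ) i : R4 →L[ℝ] ℝ).smulRight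
      (EuclideanSpace.proj (𝕜 := ℝ) j : R4 →L[ℝ] ℝ)

/-- The Christoffel symbols in the preferred chart at `p`, as a bilinear map. -/
noncomputable def gamma (p : M) (x : R4) : R4 →L[ℝ] R4 →L[ℝ] R4 :=
  ∑ k, ∑ i, ∑ j, g.christoffel p k i j x •
    (EuclideanSpace.proj (𝕜 := ℝ) i : R4 →L[ℝ] ℝ).smulRight
      ((EuclideanSpace.proj (𝕜 := ℝ) j : R4 →L[ℝ] ℝ).smulRight
        (EuclideanSpace.single k (1 : ℝ) : R4))

theorem form_apply (p : M) (x v w : R4) :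
    g.form p x v w = ∑ i, ∑ j, g.comp p x i j * (v i * w j) := by
  simp [form, sum_apply]

theorem form_single (p : M) (x : R4) (i j : Fin 4) :
    g.form p x (EuclideanSpace.single i 1) (EuclideanSpace.single j 1) = g.comp p x i j := by
  simp [form_apply]

theorem form_eq_val (p : M) (x v w : R4) : g.form p x v w
    = g.val ((extChartAt (𝓡 4) p).symm x) (frame p x v) (frame p x w) := by
  induction v using forall_of_single with
  | ha v v' h h' => simp only [map_add, add_apply, h, h']
  | hm c v h => simp only [map_smul, smul_apply, h]
  | hs i =>
    induction w using forall_of_single with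
    | ha w w' h h' => simp only [map_add, h, h']
    | hm c w h => simp only [map_smul, h]
    | hs j => rw [form_single, comp_eq_val]

theorem gamma_apply (p : M) (x v w : R4) (k : Fin 4) :
    g.gamma p x v w k = ∑ i, ∑ j, g.christoffel p k i j x * (v i * w j) := by
  simp [gamma, sum_apply, Pi.single_apply]

theorem gamma_single (p : M) (x : R4) (i j k : Fin 4) :
    g.gamma p x (EuclideanSpace.single i 1) (EuclideanSpace.single j 1) k
      = g.christoffel p k i j x := by
  simp [gamma_apply]

theorem form_symm (p : M) (x v w : R4) : g.form p x v w = g.form p x w v := by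
  rw [form_eq_val, form_eq_val, g.symm]

theorem form_nondegenerate (p : M) {x : R4} (hx : x ∈ (extChartAt (𝓡 4) p).target) (v : R4)
    (hv : ∀ w, g.form p x v w = 0) : v = 0 := by
  obtain ⟨A, hA⟩ := isInvertible_frame p hx
  have h1 : frame p x v = 0 := by
    refine g.val_nondegenerate _ _ fun w ↦ ?_
    have h2 := hv (A.symm w)
    rw [form_eq_val, ← hA, show (A : R4 →L[ℝ] _) (A.symm w) = w from A.apply_symm_apply w] at h2
    rwa [← hA]
  rw [← hA] at h1
  exact A.map_eq_zero_iff.1 h1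

theorem isUnit_det_comp (p : M) {x : R4} (hx : x ∈ (extChartAt (𝓡 4) p).target) :
    IsUnit (g.comp p x).det := by
  rw [isUnit_iff_ne_zero]
  intro h0
  obtain ⟨v, hv, hv0⟩ := Matrix.exists_mulVec_eq_zero_iff.2 h0
  refine hv ?_
  have h1 := g.form_nondegenerate p hx (WithLp.toLp 2 v) fun w ↦ ?_
  · exact congrArg WithLp.ofLp h1
  · rw [form_symm, form_apply]
    refine Finset.sum_eq_zero fun i _ ↦ ?_
    have h2 := congrFun hv0 i
    simp only [Matrix.mulVec, dotProduct, Pi.zero_apply] at h2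
    calc _ = w i * ∑ j, g.comp p x i j * v j := by
          rw [Finset.mul_sum]
          exact Finset.sum_congr rfl fun j _ ↦ by ring
      _ = 0 := by rw [h2, mul_zero]

theorem contDiffOn_comp (p : M) (i j : Fin 4) :
    ContDiffOn ℝ ∞ (fun x ↦ g.comp p x i j) (extChartAt (𝓡 4) p).target :=
  g.contDiffOn_val_frame p _ _

theorem contDiffOn_pd {f : R4 → ℝ} {s : Set R4} (hf : ContDiffOn ℝ ∞ f s) (hs : IsOpen s)
    (l : Fin 4) : ContDiffOn ℝ ∞ (pd l f) s :=
  (hf.fderiv_of_isOpen (m := ∞) hs (by simp)).clm_apply contDiffOn_const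

theorem contDiffOn_det {n : ℕ} {A : R4 → Matrix (Fin n) (Fin n) ℝ} {s : Set R4}
    (hA : ∀ i j, ContDiffOn ℝ ∞ (fun x ↦ A x i j) s) : ContDiffOn ℝ ∞ (fun x ↦ (A x).det) s := by
  simp only [Matrix.det_apply']
  exact ContDiffOn.sum fun σ _ ↦ contDiffOn_const.mul (contDiffOn_prod fun i _ ↦ hA _ _)

theorem contDiffOn_inv_comp (p : M) (i j : Fin 4) :
    ContDiffOn ℝ ∞ (fun x ↦ (g.comp p x)⁻¹ i j) (extChartAt (𝓡 4) p).target := by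
  have h1 : ContDiffOn ℝ ∞ (fun x ↦ (g.comp p x).adjugate i j) (extChartAt (𝓡 4) p).target := by
    simp only [Matrix.adjugate_apply]
    refine contDiffOn_det fun k l ↦ ?_
    by_cases hk : k = j
    · subst hk
      simp only [Matrix.updateRow_self]
      exact contDiffOn_const
    · simp only [Matrix.updateRow_ne hk]
      exact g.contDiffOn_comp p k l
  have h2 : ContDiffOn ℝ ∞ (fun x ↦ (g.comp p x).det) (extChartAt (𝓡 4) p).target :=
    contDiffOn_det fun k l ↦ g.contDiffOn_comp p k l
  simp only [Matrix.inv_def, Ring.inverse_eq_inv', Matrix.smul_apply, smul_eq_mul]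
  exact (h2.inv fun x hx ↦ (g.isUnit_det_comp p hx).ne_zero).mul h1

theorem contDiffOn_christoffel (p : M) (k i j : Fin 4) :
    ContDiffOn ℝ ∞ (g.christoffel p k i j) (extChartAt (𝓡 4) p).target := by
  have hpd := fun i j l ↦ contDiffOn_pd (g.contDiffOn_comp p i j)
    (isOpen_extChartAt_target (I := 𝓡 4) p) l
  exact contDiffOn_const.mul (ContDiffOn.sum fun l _ ↦ (g.contDiffOn_inv_comp p k l).mul
    (((hpd j l i).add (hpd i l j)).sub (hpd i j l)))

set_option maxSynthPendingDepth 2 in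
theorem contDiffOn_form (p : M) : ContDiffOn ℝ ∞ (g.form p) (extChartAt (𝓡 4) p).target :=
  ContDiffOn.sum fun i _ ↦ ContDiffOn.sum fun j _ ↦
    (g.contDiffOn_comp p i j).smul contDiffOn_const

set_option maxSynthPendingDepth 2 in
theorem contDiffOn_gamma (p : M) : ContDiffOn ℝ ∞ (g.gamma p) (extChartAt (𝓡 4) p).target :=
  ContDiffOn.sum fun k _ ↦ ContDiffOn.sum fun i _ ↦ ContDiffOn.sum fun j _ ↦
    (g.contDiffOn_christoffel p k i j).smul contDiffOn_const

theorem fderiv_form_single (p : M) {x : R4} (hx : x ∈ (extChartAt (𝓡 4) p).target)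
    (l i j : Fin 4) : fderiv ℝ (g.form p) x (EuclideanSpace.single l 1) (EuclideanSpace.single i 1)
      (EuclideanSpace.single j 1) = pd l (fun y ↦ g.comp p y i j) x := by
  have h1 : HasFDerivAt (g.form p) (fderiv ℝ (g.form p) x) x :=
    (((g.contDiffOn_form p).contDiffAt ((isOpen_extChartAt_target p).mem_nhds hx)).differentiableAt
      (by simp)).hasFDerivAt
  have h2 := (h1.clm_apply (hasFDerivAt_const (EuclideanSpace.single i (1 : ℝ) : R4) x)).clm_apply
    (hasFDerivAt_const (EuclideanSpace.single j (1 : ℝ) : R4) x)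
  simp only [form_single] at h2
  rw [pd, h2.fderiv]
  simp

theorem fderiv_gamma_single (p : M) {x : R4} (hx : x ∈ (extChartAt (𝓡 4) p).target)
    (l i j k : Fin 4) : fderiv ℝ (g.gamma p) x (EuclideanSpace.single l 1)
      (EuclideanSpace.single i 1) (EuclideanSpace.single j 1) k
        = pd l (g.christoffel p k i j) x := by
  have h1 : HasFDerivAt (g.gamma p) (fderiv ℝ (g.gamma p) x) x :=
    (((g.contDiffOn_gamma p).contDiffAt ((isOpen_extChartAt_target p).mem_nhds hx)).differentiableAt
      (by simp)).hasFDerivAt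
  have h2 := (h1.clm_apply (hasFDerivAt_const (EuclideanSpace.single i (1 : ℝ) : R4) x)).clm_apply
    (hasFDerivAt_const (EuclideanSpace.single j (1 : ℝ) : R4) x)
  have h3 := (EuclideanSpace.proj (𝕜 := ℝ) k : R4 →L[ℝ] ℝ).hasFDerivAt.comp x h2
  have h4 : (EuclideanSpace.proj (𝕜 := ℝ) k : R4 →L[ℝ] ℝ) ∘ (fun y ↦ g.gamma p y
      (EuclideanSpace.single i 1) (EuclideanSpace.single j 1)) = g.christoffel p k i j :=
    funext fun y ↦ g.gamma_single p y i j k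
  rw [h4] at h3
  rw [pd, h3.fderiv]
  simp

theorem comp_mul_christoffel (p : M) {x : R4} (hx : x ∈ (extChartAt (𝓡 4) p).target)
    (m i j : Fin 4) : ∑ k, g.comp p x m k * g.christoffel p k i j x
      = (1 / 2) * (pd i (fun y ↦ g.comp p y j m) x + pd j (fun y ↦ g.comp p y i m) x
        - pd m (fun y ↦ g.comp p y i j) x) := by
  have h1 := Matrix.mul_nonsing_inv _ (g.isUnit_det_comp p hx)
  have h2 : ∀ l, ∑ k, g.comp p x m k * (g.comp p x)⁻¹ k l = if m = l then 1 else 0 := fun l ↦ by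
    rw [← Matrix.mul_apply, h1, Matrix.one_apply]
  simp only [christoffel, Finset.mul_sum]
  rw [Finset.sum_comm]
  calc _ = ∑ l, (∑ k, g.comp p x m k * (g.comp p x)⁻¹ k l) * ((1 / 2) *
        (pd i (fun y ↦ g.comp p y j l) x + pd j (fun y ↦ g.comp p y i l) x
        - pd l (fun y ↦ g.comp p y i j) x)) := by
        refine Finset.sum_congr rfl fun l _ ↦ ?_
        rw [Finset.sum_mul]
        exact Finset.sum_congr rfl fun k _ ↦ by ring
    _ = _ := by simp [h2]

theorem isLeviCivitaOn (p : M) :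
    IsLeviCivitaOn (g.form p) (g.gamma p) (extChartAt (𝓡 4) p).target where
  isOpen := isOpen_extChartAt_target p
  contDiffOn_metric := g.contDiffOn_form p
  contDiffOn_christoffel := g.contDiffOn_gamma p
  symm x _ v w := g.form_symm p x v w
  nondegenerate x hx v hv := g.form_nondegenerate p hx v hv
  lower x hx v w z := by
    induction v using forall_of_single with
    | ha v v' h h' => simp only [map_add, add_apply, h, h']; ring
    | hm c v h => simp only [map_smul, smul_apply, smul_eq_mul, h]; ring
    | hs i =>
    induction w using forall_of_single with
    | ha w w' h h' => simp only [map_add, add_apply, h, h']; ring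
    | hm c w h => simp only [map_smul, smul_apply, smul_eq_mul, h]; ring
    | hs j =>
    induction z using forall_of_single with
    | ha z z' h h' => simp only [map_add, add_apply, h, h']; ring
    | hm c z h => simp only [map_smul, smul_apply, smul_eq_mul, h]; ring
    | hs m =>
    simp only [g.fderiv_form_single p hx]
    rw [← g.comp_mul_christoffel p hx, g.form_symm, form_apply, Finset.sum_eq_single m]
    · simp [gamma_single]
    · intro b _ hb
      simp [hb]
    · simp

theorem sum_eq_mul_sum_of_eq_mul {c : ℝ} {f f' : Fin 4 → Fin 4 → Fin 4 → ℝ}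
    (h : ∀ i j k, f' i j k = c * f i j k) :
    ∑ i, ∑ j, ∑ k, f' i j k = c * ∑ i, ∑ j, ∑ k, f i j k := by
  simp only [h, Finset.mul_sum]

/-- The minus sign is the sign convention of `riemann`. Both sides are trilinear, so coordinate
vectors suffice. -/
theorem curvatureForm_gamma (p : M) {x : R4} (hx : x ∈ (extChartAt (𝓡 4) p).target)
    (X Y Z : R4) (a : Fin 4) : curvatureForm (g.gamma p) x X Y Z a
      = -∑ b, ∑ c, ∑ d, g.riemann p a b c d x * (Z b * X c * Y d) := by
  induction X using forall_of_single with
  | ha v v' h h' =>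
    simp only [curvatureForm, map_add, add_apply, PiLp.add_apply, PiLp.sub_apply, mul_add, add_mul,
      Finset.sum_add_distrib] at *
    linarith
  | hm t v h =>
    rw [sum_eq_mul_sum_of_eq_mul (c := t)
      (f := fun b c d ↦ g.riemann p a b c d x * (Z b * v c * Y d))
      fun b c d ↦ by simp only [PiLp.smul_apply, smul_eq_mul]; ring]
    simp only [curvatureForm, map_smul, smul_apply, PiLp.add_apply, PiLp.sub_apply, PiLp.smul_apply,
      smul_eq_mul] at *
    linear_combination t * h
  | hs c₀ =>
  induction Y using forall_of_single with
  | ha v v' h h' =>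
    simp only [curvatureForm, map_add, add_apply, PiLp.add_apply, PiLp.sub_apply, mul_add,
      Finset.sum_add_distrib] at *
    linarith
  | hm t v h =>
    rw [sum_eq_mul_sum_of_eq_mul (c := t)
      (f := fun b c d ↦ g.riemann p a b c d x * (Z b * (EuclideanSpace.single c₀ 1 : R4) c * v d))
      fun b c d ↦ by simp only [PiLp.smul_apply, smul_eq_mul]; ring]
    simp only [curvatureForm, map_smul, smul_apply, PiLp.add_apply, PiLp.sub_apply, PiLp.smul_apply,
      smul_eq_mul] at *
    linear_combination t * h
  | hs d₀ =>
  induction Z using forall_of_single with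
  | ha v v' h h' =>
    simp only [curvatureForm, map_add, PiLp.add_apply, PiLp.sub_apply, mul_add, add_mul,
      Finset.sum_add_distrib] at *
    linarith
  | hm t v h =>
    rw [sum_eq_mul_sum_of_eq_mul (c := t)
      (f := fun b c d ↦ g.riemann p a b c d x * (v b *
        (EuclideanSpace.single c₀ 1 : R4) c * (EuclideanSpace.single d₀ 1 : R4) d))
      fun b c d ↦ by simp only [PiLp.smul_apply, smul_eq_mul]; ring]
    simp only [curvatureForm, map_smul, PiLp.add_apply, PiLp.sub_apply, PiLp.smul_apply,
      smul_eq_mul] at *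
    linear_combination t * h
  | hs b =>
    have h1 : ∀ c d, g.gamma p x (EuclideanSpace.single c 1) (g.gamma p x
        (EuclideanSpace.single d 1) (EuclideanSpace.single b 1)) a
        = ∑ e, g.christoffel p a c e x * g.christoffel p e d b x := fun c d ↦ by
      rw [gamma_apply, Finset.sum_eq_single c]
      · simp [gamma_single]
      · intro i _ hi
        simp [hi]
      · simp
    simp only [curvatureForm, PiLp.add_apply, PiLp.sub_apply, fderiv_gamma_single g p hx, h1]
    have h2 : ∑ b', ∑ c, ∑ d, g.riemann p a b' c d x * ((EuclideanSpace.single b 1 : R4) b' *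
        (EuclideanSpace.single c₀ 1 : R4) c * (EuclideanSpace.single d₀ 1 : R4) d)
        = g.riemann p a b c₀ d₀ x := by
      simp
    rw [h2, riemann, Finset.sum_sub_distrib]
    ring

/-- By the sign convention the contraction is `-G(X, R(X,Y)Y)`; skew-symmetry of `R(X,Y)` moves it
to the form produced by the Jacobi field expansion. -/
theorem sectional_eq (q : M) (X Y : R4) : g.sectional q X Y
    = g.form q (extChartAt (𝓡 4) q q)
      (curvatureForm (g.gamma q) (extChartAt (𝓡 4) q q) X Y X) Y := by
  have hx : extChartAt (𝓡 4) q q ∈ (extChartAt (𝓡 4) q).target := mem_extChartAt_target q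
  rw [(g.isLeviCivitaOn q).curvatureForm_antisymm hx, form_apply]
  simp only [sectional, g.curvatureForm_gamma q hx, mul_neg, Finset.sum_neg_distrib, neg_neg]
  refine Finset.sum_congr rfl fun a _ ↦ ?_
  simp only [Finset.mul_sum, Finset.sum_mul]
  calc _ = ∑ b, ∑ c, ∑ e, ∑ d, g.comp q (extChartAt (𝓡 4) q q) a e
          * g.riemann q e b c d (extChartAt (𝓡 4) q q) * X a * Y b * X c * Y d :=
        Finset.sum_congr rfl fun b _ ↦ Finset.sum_congr rfl fun c _ ↦ Finset.sum_comm
    _ = ∑ b, ∑ e, ∑ c, ∑ d, g.comp q (extChartAt (𝓡 4) q q) a e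
          * g.riemann q e b c d (extChartAt (𝓡 4) q q) * X a * Y b * X c * Y d :=
        Finset.sum_congr rfl fun b _ ↦ Finset.sum_comm
    _ = _ := by
      rw [Finset.sum_comm]
      refine Finset.sum_congr rfl fun e _ ↦ Finset.sum_congr rfl fun b _ ↦
        Finset.sum_congr rfl fun c _ ↦ Finset.sum_congr rfl fun d _ ↦ by ring

end LorentzMetric

end

/-! ### Isometries and change of charts -/

section

open Filter Topology

theorem two_le_infty : (2 : ℕ∞ω) ≤ ∞ := WithTop.coe_le_coe.2 le_top

theorem ContDiffAt.deriv_one {E : Type*} [NormedAddCommGroup E] [NormedSpace ℝ E] {c : ℝ → E}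
    {u : ℝ} (hc : ContDiffAt ℝ 2 c u) : ContDiffAt ℝ 1 (deriv c) u := by
  have h1 := (hc.fderiv_right (m := 1) (by norm_num)).clm_apply
    (contDiffAt_const (c := (1 : ℝ)))
  simpa only [fderiv_apply_one_eq_deriv] using h1

namespace IsLeviCivitaOn

variable {E : Type*} [NormedAddCommGroup E] [NormedSpace ℝ E]
  {G₁ G₂ : E → E →L[ℝ] E →L[ℝ] ℝ} {Γ₁ Γ₂ : E → E →L[ℝ] E →L[ℝ] E} {s₁ s₂ : Set E} {ψ : E → E}
  {x : E}

set_option maxSynthPendingDepth 2 in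
/-- The derivative of a pulled back metric. -/
theorem fderiv_metric_of_isometry (h₁ : IsLeviCivitaOn G₁ Γ₁ s₁) (h₂ : IsLeviCivitaOn G₂ Γ₂ s₂)
    (hx₁ : x ∈ s₁) (hx₂ : ψ x ∈ s₂) (hψ : ContDiffAt ℝ 2 ψ x)
    (hiso : ∀ᶠ y in 𝓝 x, ∀ v w, G₁ y v w = G₂ (ψ y) (fderiv ℝ ψ y v) (fderiv ℝ ψ y w))
    (u v w : E) : fderiv ℝ G₁ x u v w
      = fderiv ℝ G₂ (ψ x) (fderiv ℝ ψ x u) (fderiv ℝ ψ x v) (fderiv ℝ ψ x w)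
        + G₂ (ψ x) (fderiv ℝ (fderiv ℝ ψ) x u v) (fderiv ℝ ψ x w)
        + G₂ (ψ x) (fderiv ℝ ψ x v) (fderiv ℝ (fderiv ℝ ψ) x u w) := by
  have hc := fun y : E ↦ hasFDerivAt_const (𝕜 := ℝ) y x
  have h1 := ((h₁.hasFDerivAt_metric hx₁).clm_apply (hc v)).clm_apply (hc w)
  have hψ1 := (hψ.differentiableAt (by simp)).hasFDerivAt
  have hψ2 := ((hψ.fderiv_right (m := 1) (by norm_num)).differentiableAt (by simp)).hasFDerivAt
  have h2 := (((h₂.hasFDerivAt_metric hx₂).comp x hψ1).clm_apply (hψ2.clm_apply (hc v))).clm_apply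
    (hψ2.clm_apply (hc w))
  have h3 : (fun y ↦ G₁ y v w)
      =ᶠ[𝓝 x] fun y ↦ G₂ (ψ y) (fderiv ℝ ψ y v) (fderiv ℝ ψ y w) := by
    filter_upwards [hiso] with y hy using hy v w
  have h4 := congrArg (fun A : E →L[ℝ] ℝ ↦ A u) (h1.unique (h2.congr_of_eventuallyEq h3))
  simp at h4
  rw [h4]
  ring

/-- The transformation law of the Christoffel symbols under an isometry. -/
theorem christoffel_of_isometry (h₁ : IsLeviCivitaOn G₁ Γ₁ s₁) (h₂ : IsLeviCivitaOn G₂ Γ₂ s₂)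
    (hx₁ : x ∈ s₁) (hx₂ : ψ x ∈ s₂) (hψ : ContDiffAt ℝ 2 ψ x)
    (hsurj : Function.Surjective (fderiv ℝ ψ x))
    (hiso : ∀ᶠ y in 𝓝 x, ∀ v w, G₁ y v w = G₂ (ψ y) (fderiv ℝ ψ y v) (fderiv ℝ ψ y w))
    (v w : E) : fderiv ℝ ψ x (Γ₁ x v w) = fderiv ℝ (fderiv ℝ ψ) x v w
      + Γ₂ (ψ x) (fderiv ℝ ψ x v) (fderiv ℝ ψ x w) := by
  refine sub_eq_zero.1 (h₂.nondegenerate _ hx₂ _ fun z' ↦ ?_)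
  -- Every test vector is some `Dψ z`. Inserting the derivatives of the pulled back metric in the
  -- formula for `G₁(Γ₁(v,w), z)`, the second derivatives of `ψ` cancel by symmetry except for
  -- `G₂(D²ψ(v,w), Dψ z)`.
  obtain ⟨z, rfl⟩ := hsurj z'
  have hs := fun u v ↦ (hψ.isSymmSndFDerivAt (by simp)).eq u v
  have hd := fun u v w ↦ h₁.fderiv_metric_of_isometry h₂ hx₁ hx₂ hψ hiso u v w
  have h3 := h₁.lower x hx₁ v w z
  rw [hiso.self_of_nhds, hd, hd, hd, hs w v, hs z w, hs z v,
    h₂.symm _ hx₂ (fderiv ℝ ψ x v), h₂.symm _ hx₂ (fderiv ℝ ψ x w)] at h3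
  rw [map_sub, sub_apply, map_add, add_apply, h₂.lower _ hx₂, h3]
  ring

/-- Isometries map geodesics to geodesics. -/
theorem geodesic_of_isometry (h₁ : IsLeviCivitaOn G₁ Γ₁ s₁) (h₂ : IsLeviCivitaOn G₂ Γ₂ s₂)
    {c : ℝ → E} {u : ℝ} (hc : ContDiffAt ℝ 2 c u)
    (hx₁ : c u ∈ s₁) (hx₂ : ψ (c u) ∈ s₂) (hψ : ContDiffAt ℝ 2 ψ (c u))
    (hsurj : Function.Surjective (fderiv ℝ ψ (c u)))
    (hiso : ∀ᶠ y in 𝓝 (c u), ∀ v w, G₁ y v w = G₂ (ψ y) (fderiv ℝ ψ y v) (fderiv ℝ ψ y w))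
    (hgeo : deriv (deriv c) u + Γ₁ (c u) (deriv c u) (deriv c u) = 0) :
    deriv (deriv (ψ ∘ c)) u
      + Γ₂ ((ψ ∘ c) u) (deriv (ψ ∘ c) u) (deriv (ψ ∘ c) u) = 0 := by
  have hd : ∀ᶠ v in 𝓝 u, deriv (ψ ∘ c) v = fderiv ℝ ψ (c v) (deriv c v) := by
    filter_upwards [hc.eventually (by simp), hc.continuousAt.eventually (hψ.eventually (by simp))]
      with v hv hv'
    exact ((hv'.differentiableAt (by simp)).hasFDerivAt.comp_hasDerivAt v
      (hv.differentiableAt (by simp)).hasDerivAt).deriv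
  have hψ2 := ((hψ.fderiv_right (m := 1) (by norm_num)).differentiableAt (by simp)).hasFDerivAt
  have hc1 := (hc.differentiableAt (by simp)).hasDerivAt
  have hc2 : HasDerivAt (deriv c) (deriv (deriv c) u) u :=
    (hc.deriv_one.differentiableAt (by simp)).hasDerivAt
  have h2 := ((hψ2.comp_hasDerivAt u hc1).clm_apply hc2).congr_of_eventuallyEq hd
  rw [h2.deriv, hd.self_of_nhds, Function.comp_apply]
  have h3 := h₁.christoffel_of_isometry h₂ hx₁ hx₂ hψ hsurj hiso (deriv c u) (deriv c u)
  have h4 := congrArg (fderiv ℝ ψ (c u)) hgeo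
  rw [map_add, map_zero, h3] at h4
  rw [← h4]
  simp only [Function.comp_apply]
  abel

end IsLeviCivitaOn

variable {M : Type*} [TopologicalSpace M] [ChartedSpace R4 M]

namespace LorentzMetric

/-- The change of coordinates between two preferred charts. -/
noncomputable def transition (p p' : M) : R4 → R4 :=
  fun x ↦ extChartAt (𝓡 4) p' ((extChartAt (𝓡 4) p).symm x)

theorem eventually_symm_mem_source (p p' : M) {x : R4} (hx : x ∈ (extChartAt (𝓡 4) p).target)
    (hx' : (extChartAt (𝓡 4) p).symm x ∈ (extChartAt (𝓡 4) p').source) :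
    ∀ᶠ y in 𝓝 x, y ∈ (extChartAt (𝓡 4) p).target ∧
      (extChartAt (𝓡 4) p).symm y ∈ (extChartAt (𝓡 4) p').source := by
  filter_upwards [(isOpen_extChartAt_target p).mem_nhds hx,
    (continuousAt_extChartAt_symm'' hx).preimage_mem_nhds
      ((isOpen_extChartAt_source p').mem_nhds hx')] with y h1 h2 using ⟨h1, h2⟩

theorem symm_transition (p p' : M) {x : R4}
    (hx' : (extChartAt (𝓡 4) p).symm x ∈ (extChartAt (𝓡 4) p').source) :
    (extChartAt (𝓡 4) p').symm (transition p p' x) = (extChartAt (𝓡 4) p).symm x :=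
  (extChartAt (𝓡 4) p').left_inv hx'

variable [IsManifold (𝓡 4) ∞ M]

theorem contDiffAt_transition (p p' : M) {x : R4} (hx : x ∈ (extChartAt (𝓡 4) p).target)
    (hx' : (extChartAt (𝓡 4) p).symm x ∈ (extChartAt (𝓡 4) p').source) :
    ContDiffAt ℝ ∞ (transition p p') x := by
  have h1 : x ∈ ((extChartAt (𝓡 4) p).symm ≫ extChartAt (𝓡 4) p').source := by
    rw [PartialEquiv.trans_source, PartialEquiv.symm_source]
    exact ⟨hx, hx'⟩
  have h2 := contDiffWithinAt_ext_coord_change (I := 𝓡 4) (n := ∞) p' p h1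
  rw [ModelWithCorners.range_eq_univ, contDiffWithinAt_univ] at h2
  exact h2

theorem mdifferentiableAt_symm (p : M) {x : R4} (hx : x ∈ (extChartAt (𝓡 4) p).target) :
    MDifferentiableAt 𝓘(ℝ, R4) (𝓡 4) (extChartAt (𝓡 4) p).symm x :=
  ((contMDiffOn_extChartAt_symm (I := 𝓡 4) (n := ∞) p).contMDiffAt
    ((isOpen_extChartAt_target p).mem_nhds hx)).mdifferentiableAt (by simp)

/-- The chain rule. The equation is stated in `R4` because the two base points are equal only
propositionally, so the tangent spaces are different types; `val_congr` later transports along that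
equality. -/
theorem frame_eq_frame_transition (p p' : M) {x : R4} (hx : x ∈ (extChartAt (𝓡 4) p).target)
    (hx' : (extChartAt (𝓡 4) p).symm x ∈ (extChartAt (𝓡 4) p').source) (v : R4) :
    (frame p x v : R4) = (frame p' (transition p p' x) (fderiv ℝ (transition p p') x v) : R4) := by
  have h1 : (extChartAt (𝓡 4) p).symm
      =ᶠ[𝓝 x] (extChartAt (𝓡 4) p').symm ∘ transition p p' := by
    filter_upwards [eventually_symm_mem_source p p' hx hx'] with y hy
      using (symm_transition p p' hy.2).symm
  have h2 : MDifferentiableAt 𝓘(ℝ, R4) 𝓘(ℝ, R4) (transition p p') x :=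
    ((contDiffAt_transition p p' hx hx').differentiableAt (by simp)).mdifferentiableAt
  have h3 : MDifferentiableAt 𝓘(ℝ, R4) (𝓡 4) (extChartAt (𝓡 4) p').symm (transition p p' x) :=
    mdifferentiableAt_symm p' ((extChartAt (𝓡 4) p').map_source hx')
  have h4 := mfderiv_comp x h3 h2
  have h5 := h1.mfderiv_eq (I := 𝓘(ℝ, R4)) (I' := 𝓡 4)
  rw [h4, mfderiv_eq_fderiv] at h5
  exact congrArg (fun A : R4 →L[ℝ] R4 ↦ A v) h5

variable (g : LorentzMetric M)

theorem val_congr {y y' : M} (h : y = y') {v w v' w' : R4} (hv : v = v') (hw : w = w') :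
    g.val y v w = g.val y' v' w' := by
  subst h hv hw
  rfl

theorem form_transition (p p' : M) {x : R4} (hx : x ∈ (extChartAt (𝓡 4) p).target)
    (hx' : (extChartAt (𝓡 4) p).symm x ∈ (extChartAt (𝓡 4) p').source) (v w : R4) :
    g.form p x v w = g.form p' (transition p p' x) (fderiv ℝ (transition p p') x v)
      (fderiv ℝ (transition p p') x w) := by
  rw [form_eq_val, form_eq_val]
  exact g.val_congr (symm_transition p p' hx').symm (frame_eq_frame_transition p p' hx hx' v)
    (frame_eq_frame_transition p p' hx hx' w)

/-- Injectivity follows from that of `frame p`, which factors through this derivative; the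
dimensions agree. -/
theorem surjective_fderiv_transition (p p' : M) {x : R4} (hx : x ∈ (extChartAt (𝓡 4) p).target)
    (hx' : (extChartAt (𝓡 4) p).symm x ∈ (extChartAt (𝓡 4) p').source) :
    Function.Surjective (fderiv ℝ (transition p p') x) := by
  refine (LinearMap.injective_iff_surjective (f := (fderiv ℝ (transition p p') x).toLinearMap)).1 ?_
  refine (injective_iff_map_eq_zero _).2 fun v hv ↦ ?_
  obtain ⟨A, hA⟩ := isInvertible_frame p hx
  have h1 := frame_eq_frame_transition p p' hx hx' v
  rw [show fderiv ℝ (transition p p') x v = 0 from hv, ← hA] at h1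
  refine A.map_eq_zero_iff.1 (h1.trans ?_)
  exact map_zero (frame p' (transition p p' x))

/-- The geodesic equation does not depend on the chart. -/
theorem geodesic_transition (p p' : M) {c : ℝ → R4} {u : ℝ} (hc : ContDiffAt ℝ 2 c u)
    (hx : c u ∈ (extChartAt (𝓡 4) p).target)
    (hx' : (extChartAt (𝓡 4) p).symm (c u) ∈ (extChartAt (𝓡 4) p').source)
    (hgeo : deriv (deriv c) u + g.gamma p (c u) (deriv c u) (deriv c u) = 0) :
    deriv (deriv (transition p p' ∘ c)) u + g.gamma p' ((transition p p' ∘ c) u)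
      (deriv (transition p p' ∘ c) u) (deriv (transition p p' ∘ c) u) = 0 := by
  refine (g.isLeviCivitaOn p).geodesic_of_isometry (g.isLeviCivitaOn p') hc hx
    ((extChartAt (𝓡 4) p').map_source hx') ((contDiffAt_transition p p' hx hx').of_le two_le_infty)
    (surjective_fderiv_transition p p' hx hx') ?_ hgeo
  filter_upwards [eventually_symm_mem_source p p' hx hx'] with y hy v w
    using g.form_transition p p' hy.1 hy.2 v w

theorem deriv_proj {c : ℝ → R4} {u : ℝ} (hc : DifferentiableAt ℝ c u) (k : Fin 4) :
    deriv (fun v ↦ c v k) u = deriv c u k :=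
  ((EuclideanSpace.proj (𝕜 := ℝ) k : R4 →L[ℝ] ℝ).hasFDerivAt.comp_hasDerivAt u
    hc.hasDerivAt).deriv

theorem geodesic_components_iff (p : M) {c : ℝ → R4} {u : ℝ} (hc : ContDiffAt ℝ 2 c u) :
    (∀ k : Fin 4, deriv (deriv fun v ↦ c v k) u + ∑ i, ∑ j, g.christoffel p k i j (c u)
      * deriv (fun v ↦ c v i) u * deriv (fun v ↦ c v j) u = 0) ↔
    deriv (deriv c) u + g.gamma p (c u) (deriv c u) (deriv c u) = 0 := by
  have h1 : ∀ k, deriv (deriv fun v ↦ c v k) u = deriv (deriv c) u k := fun k ↦ by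
    rw [← deriv_proj (hc.deriv_one.differentiableAt (by simp))]
    refine Filter.EventuallyEq.deriv_eq ?_
    filter_upwards [hc.eventually (by simp)] with v hv
      using deriv_proj (hv.differentiableAt (by simp)) k
  rw [PiLp.ext_iff]
  refine forall_congr' fun k ↦ ?_
  simp only [h1, deriv_proj (hc.differentiableAt (by simp)), PiLp.add_apply, gamma_apply,
    PiLp.zero_apply, mul_assoc]

end LorentzMetric

end

/-! ### Uniqueness of geodesics -/

section

open Filter Topology

/-- A geodesic is determined to the right of a point by its position and velocity. -/
theorem eventually_eq_of_geodesic {E : Type*} [NormedAddCommGroup E] [NormedSpace ℝ E]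
    {Γ : E → E →L[ℝ] E →L[ℝ] E} {c₁ c₂ : ℝ → E} {a : ℝ} (hΓ : ContDiffAt ℝ 1 Γ (c₁ a))
    (h₁ : ∀ᶠ u in 𝓝[≥] a, ContDiffAt ℝ 2 c₁ u ∧
      deriv (deriv c₁) u + Γ (c₁ u) (deriv c₁ u) (deriv c₁ u) = 0)
    (h₂ : ∀ᶠ u in 𝓝[≥] a, ContDiffAt ℝ 2 c₂ u ∧
      deriv (deriv c₂) u + Γ (c₂ u) (deriv c₂ u) (deriv c₂ u) = 0)
    (h₀ : c₁ a = c₂ a) (h₀' : deriv c₁ a = deriv c₂ a) :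
    ∀ᶠ u in 𝓝[≥] a, c₁ u = c₂ u ∧ deriv c₁ u = deriv c₂ u := by
  -- The geodesic equation as a first-order system on position and velocity; its right-hand side is
  -- `C¹`, hence locally Lipschitz.
  set F : E × E → E × E := fun z ↦ (z.2, -Γ z.1 z.2 z.2) with hF
  have hF1 : ContDiffAt ℝ 1 F (c₁ a, deriv c₁ a) := by
    refine contDiffAt_snd.prodMk (ContDiffAt.neg ?_)
    exact ((hΓ.comp (c₁ a, deriv c₁ a) contDiffAt_fst).clm_apply contDiffAt_snd).clm_apply
      contDiffAt_snd
  obtain ⟨K, t, ht, hK⟩ := hF1.exists_lipschitzOnWith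
  have hlift : ∀ c : ℝ → E, (∀ᶠ u in 𝓝[≥] a, ContDiffAt ℝ 2 c u ∧
      deriv (deriv c) u + Γ (c u) (deriv c u) (deriv c u) = 0) → t ∈ 𝓝 (c a, deriv c a) →
      ∀ᶠ u in 𝓝[≥] a, HasDerivAt (fun u ↦ (c u, deriv c u)) (F (c u, deriv c u)) u ∧
        (c u, deriv c u) ∈ t := by
    intro c hc htc
    have ha := (hc.self_of_nhdsWithin self_mem_Ici).1
    have h3 : ContinuousAt (fun u ↦ (c u, deriv c u)) a :=
      ha.continuousAt.prodMk ha.deriv_one.continuousAt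
    filter_upwards [hc, h3.continuousWithinAt.preimage_mem_nhdsWithin htc] with u hu hu'
    refine ⟨?_, hu'⟩
    have h4 := (hu.1.deriv_one.differentiableAt (by simp)).hasDerivAt
    rw [eq_neg_of_add_eq_zero_left hu.2] at h4
    exact (hu.1.differentiableAt (by simp)).hasDerivAt.prodMk h4
  have h5 := (hlift c₁ h₁ ht).and (hlift c₂ h₂ (by rwa [← h₀, ← h₀']))
  obtain ⟨b, hb, hb'⟩ := (mem_nhdsGE_iff_exists_Icc_subset (a := a)).1 h5
  have h6 := ODE_solution_unique_of_mem_Icc_right (v := fun _ ↦ F) (s := fun _ ↦ t) (K := K)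
    (f := fun u ↦ (c₁ u, deriv c₁ u)) (g := fun u ↦ (c₂ u, deriv c₂ u)) (a := a) (b := b)
    (fun _ _ ↦ hK)
    (fun u hu ↦ (hb' hu).1.1.continuousAt.continuousWithinAt)
    (fun u hu ↦ (hb' (Ico_subset_Icc_self hu)).1.1.hasDerivWithinAt)
    (fun u hu ↦ (hb' (Ico_subset_Icc_self hu)).1.2)
    (fun u hu ↦ (hb' hu).2.1.continuousAt.continuousWithinAt)
    (fun u hu ↦ (hb' (Ico_subset_Icc_self hu)).2.1.hasDerivWithinAt)
    (fun u hu ↦ (hb' (Ico_subset_Icc_self hu)).2.2) (by simp [h₀, h₀'])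
  filter_upwards [Icc_mem_nhdsGE hb] with u hu using Prod.ext_iff.1 (h6 hu)

variable {M : Type*} [TopologicalSpace M] [ChartedSpace R4 M]
namespace LorentzMetric

theorem tangentBundle_ext_iff {y y' : M} {v v' : R4} :
    ((⟨y, v⟩ : TangentBundle (𝓡 4) M) = ⟨y', v'⟩) ↔ y = y' ∧ v = v' := by
  constructor
  · intro h
    exact ⟨congrArg Bundle.TotalSpace.proj h,
      congrArg (fun z : TangentBundle (𝓡 4) M ↦ (z.2 : R4)) h⟩
  · rintro ⟨rfl, rfl⟩
    rfl

variable [IsManifold (𝓡 4) ∞ M]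

variable {γ γ₁ γ₂ : ℝ → M} {p : M} {u : ℝ}

theorem contDiffAt_chart_comp {n : ℕ∞ω} (hn : n ≤ ∞)
    (hγ : ContMDiffAt 𝓘(ℝ, ℝ) (𝓡 4) n γ u)
    (hp : γ u ∈ (extChartAt (𝓡 4) p).source) :
    ContDiffAt ℝ n (fun v ↦ extChartAt (𝓡 4) p (γ v)) u := by
  rw [extChartAt_source] at hp
  exact (((contMDiffAt_extChartAt' (I := 𝓡 4) (n := ∞) hp).of_le hn).comp u hγ).contDiffAt

theorem deriv_chart_comp (hγ : MDifferentiableAt 𝓘(ℝ, ℝ) (𝓡 4) γ u)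
    (hp : γ u ∈ (extChartAt (𝓡 4) p).source) :
    deriv (fun v ↦ extChartAt (𝓡 4) p (γ v)) u
      = mfderiv (𝓡 4) 𝓘(ℝ, R4) (extChartAt (𝓡 4) p) (γ u) (velocity γ u) := by
  rw [extChartAt_source] at hp
  have h1 := mfderiv_comp u ((contMDiffAt_extChartAt' (I := 𝓡 4) (n := ∞) hp).mdifferentiableAt
    (by simp)) hγ
  rw [mfderiv_eq_fderiv] at h1
  rw [← fderiv_apply_one_eq_deriv]
  exact congrArg (fun A : ℝ →L[ℝ] R4 ↦ A 1) h1

theorem velocity_eq_frame (hγ : MDifferentiableAt 𝓘(ℝ, ℝ) (𝓡 4) γ u)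
    (hp : γ u ∈ (extChartAt (𝓡 4) p).source) :
    (velocity γ u : R4) = (frame p (extChartAt (𝓡 4) p (γ u))
      (deriv (fun v ↦ extChartAt (𝓡 4) p (γ v)) u) : R4) := by
  have hp' := hp
  rw [extChartAt_source] at hp'
  have h0 := (contMDiffAt_extChartAt' (I := 𝓡 4) (n := ∞) hp').mdifferentiableAt (by simp)
  have h2 : γ =ᶠ[𝓝 u] (extChartAt (𝓡 4) p).symm ∘ (fun v ↦ extChartAt (𝓡 4) p (γ v)) := by
    filter_upwards [hγ.continuousAt.preimage_mem_nhds ((isOpen_extChartAt_source p).mem_nhds hp)]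
      with v hv using ((extChartAt (𝓡 4) p).left_inv hv).symm
  have h1 := mfderiv_comp u (mdifferentiableAt_symm p ((extChartAt (𝓡 4) p).map_source hp))
    (h0.comp u hγ)
  have h3 := h2.mfderiv_eq (I := 𝓘(ℝ, ℝ)) (I' := 𝓡 4)
  rw [← fderiv_apply_one_eq_deriv, ← mfderiv_eq_fderiv]
  exact congrArg (fun A : ℝ →L[ℝ] R4 ↦ A 1) (h3.trans h1)

theorem velocity_eq_iff (hγ₁ : MDifferentiableAt 𝓘(ℝ, ℝ) (𝓡 4) γ₁ u)
    (hγ₂ : MDifferentiableAt 𝓘(ℝ, ℝ) (𝓡 4) γ₂ u) (hγ : γ₁ u = γ₂ u)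
    (hp : γ₁ u ∈ (extChartAt (𝓡 4) p).source) :
    (velocity γ₁ u : R4) = velocity γ₂ u ↔ deriv (fun v ↦ extChartAt (𝓡 4) p (γ₁ v)) u
      = deriv (fun v ↦ extChartAt (𝓡 4) p (γ₂ v)) u := by
  constructor
  · intro h
    rw [deriv_chart_comp hγ₁ hp, deriv_chart_comp hγ₂ (hγ ▸ hp)]
    exact congr_arg₂ (fun (y : M) (w : R4) ↦
      (mfderiv (𝓡 4) 𝓘(ℝ, R4) (extChartAt (𝓡 4) p) y : R4 →L[ℝ] R4) w) hγ h
  · intro h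
    rw [velocity_eq_frame hγ₁ hp, velocity_eq_frame hγ₂ (hγ ▸ hp)]
    exact congr_arg₂ (fun (y : M) (w : R4) ↦
      (frame p (extChartAt (𝓡 4) p y) w : R4)) hγ h

variable (g : LorentzMetric M)

variable {g} in
theorem IsGeodesicOn.chart {s : Set ℝ} (h : g.IsGeodesicOn γ s) (hu : u ∈ s)
    (hp : γ u ∈ (extChartAt (𝓡 4) p).source) :
    deriv (deriv fun v ↦ extChartAt (𝓡 4) p (γ v)) u
      + g.gamma p (extChartAt (𝓡 4) p (γ u)) (deriv (fun v ↦ extChartAt (𝓡 4) p (γ v)) u)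
        (deriv (fun v ↦ extChartAt (𝓡 4) p (γ v)) u) = 0 := by
  obtain ⟨h1, h2⟩ := h u hu
  refine (g.geodesic_components_iff p (contDiffAt_chart_comp two_le_infty h1 hp)).1 ?_
  rw [extChartAt_source] at hp
  exact h2 p hp

/-- A curve which satisfies the geodesic equation in one chart is a geodesic. -/
theorem isGeodesicOn_of_chart (p : M) {c : ℝ → R4} {s : Set ℝ} (hc : ∀ u ∈ s, ContDiffAt ℝ 2 c u)
    (ht : ∀ u ∈ s, c u ∈ (extChartAt (𝓡 4) p).target)
    (hgeo : ∀ u ∈ s, deriv (deriv c) u + g.gamma p (c u) (deriv c u) (deriv c u) = 0) :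
    g.IsGeodesicOn (fun u ↦ (extChartAt (𝓡 4) p).symm (c u)) s := by
  intro u hu
  constructor
  · exact (((contMDiffOn_extChartAt_symm (I := 𝓡 4) (n := ∞) p).contMDiffAt
      ((isOpen_extChartAt_target p).mem_nhds (ht u hu))).of_le two_le_infty).comp u
      (hc u hu).contMDiffAt
  · intro p' hp'
    rw [← extChartAt_source (𝓡 4)] at hp'
    refine (g.geodesic_components_iff p' ?_).2
      (g.geodesic_transition p p' (hc u hu) (ht u hu) hp' (hgeo u hu))
    exact ((contDiffAt_transition p p' (ht u hu) hp').of_le two_le_infty).comp u (hc u hu)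

variable {g}

/-- Geodesics on `[0,1]` are determined by their initial position and velocity. -/
theorem IsGeodesicOn.eqOn [T2Space M] (h₁ : g.IsGeodesicOn γ₁ (Icc 0 1))
    (h₂ : g.IsGeodesicOn γ₂ (Icc 0 1)) (h₀ : γ₁ 0 = γ₂ 0)
    (h₀' : (velocity γ₁ 0 : R4) = velocity γ₂ 0) : EqOn γ₁ γ₂ (Icc 0 1) := by
  set S : Set ℝ := {u | γ₁ u = γ₂ u ∧ (velocity γ₁ u : R4) = velocity γ₂ u} with hS
  have hd : ∀ {γ : ℝ → M} {u : ℝ}, g.IsGeodesicOn γ (Icc 0 1) → u ∈ Icc (0 : ℝ) 1 →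
      MDifferentiableAt 𝓘(ℝ, ℝ) (𝓡 4) γ u := fun h hu ↦ (h _ hu).1.mdifferentiableAt (by simp)
  suffices h : Icc 0 1 ⊆ S from fun u hu ↦ (h hu).1
  -- The set of agreement of position and velocity is closed in `[0,1]`, where equality of the
  -- limits of the positions uses the Hausdorff property, and it extends to the right of each of its
  -- points by local uniqueness in a chart.
  refine IsClosed.Icc_subset_of_forall_mem_nhdsWithin ?_ ⟨h₀, h₀'⟩ ?_
  · refine isClosed_of_closure_subset fun u hu ↦ ?_
    have huI : u ∈ Icc (0 : ℝ) 1 :=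
      closure_minimal inter_subset_right isClosed_Icc hu
    have : (𝓝[S ∩ Icc 0 1] u).NeBot := mem_closure_iff_nhdsWithin_neBot.1 hu
    have h3 : γ₁ u = γ₂ u := by
      refine tendsto_nhds_unique_of_eventuallyEq (l := 𝓝[S ∩ Icc 0 1] u)
        ((h₁ u huI).1.continuousAt.mono_left nhdsWithin_le_nhds)
        ((h₂ u huI).1.continuousAt.mono_left nhdsWithin_le_nhds) ?_
      filter_upwards [self_mem_nhdsWithin] with v hv using hv.1.1
    refine ⟨⟨h3, ?_⟩, huI⟩
    have hp : γ₁ u ∈ (extChartAt (𝓡 4) (γ₁ u)).source := mem_extChartAt_source _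
    rw [velocity_eq_iff (hd h₁ huI) (hd h₂ huI) h3 hp]
    refine tendsto_nhds_unique_of_eventuallyEq (l := 𝓝[S ∩ Icc 0 1] u)
        ((contDiffAt_chart_comp two_le_infty (h₁ u huI).1
          hp).deriv_one.continuousAt.mono_left nhdsWithin_le_nhds)
        ((contDiffAt_chart_comp two_le_infty (h₂ u huI).1
          (h3 ▸ hp)).deriv_one.continuousAt.mono_left nhdsWithin_le_nhds) ?_
    filter_upwards [self_mem_nhdsWithin, mem_nhdsWithin_of_mem_nhds
      ((h₁ u huI).1.continuousAt.preimage_mem_nhds ((isOpen_extChartAt_source _).mem_nhds hp))]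
      with v hv hv'
    exact (velocity_eq_iff (hd h₁ hv.2) (hd h₂ hv.2) hv.1.1 hv').1 hv.1.2
  · intro u hu
    have huI : u ∈ Icc (0 : ℝ) 1 := Ico_subset_Icc_self hu.2
    have hp : γ₁ u ∈ (extChartAt (𝓡 4) (γ₁ u)).source := mem_extChartAt_source _
    have hI : Icc (0 : ℝ) 1 ∈ 𝓝[≥] u := Icc_mem_nhdsGE_of_mem hu.2
    have hsrc : ∀ {γ : ℝ → M}, g.IsGeodesicOn γ (Icc 0 1) → γ u = γ₁ u →
        ∀ᶠ v in 𝓝[≥] u, γ v ∈ (extChartAt (𝓡 4) (γ₁ u)).source := fun h h' ↦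
      mem_nhdsWithin_of_mem_nhds ((h u huI).1.continuousAt.preimage_mem_nhds
        ((isOpen_extChartAt_source _).mem_nhds (h' ▸ hp)))
    have hloc : ∀ {γ : ℝ → M}, g.IsGeodesicOn γ (Icc 0 1) → γ u = γ₁ u → ∀ᶠ v in 𝓝[≥] u,
        ContDiffAt ℝ 2 (fun v ↦ extChartAt (𝓡 4) (γ₁ u) (γ v)) v ∧
        deriv (deriv fun v ↦ extChartAt (𝓡 4) (γ₁ u) (γ v)) v
          + g.gamma (γ₁ u) (extChartAt (𝓡 4) (γ₁ u) (γ v))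
            (deriv (fun v ↦ extChartAt (𝓡 4) (γ₁ u) (γ v)) v)
            (deriv (fun v ↦ extChartAt (𝓡 4) (γ₁ u) (γ v)) v) = 0 := by
      intro γ h h'
      filter_upwards [hI, hsrc h h'] with v hv hv'
        using ⟨contDiffAt_chart_comp two_le_infty (h v hv).1 hv', h.chart hv hv'⟩
    have h4 := eventually_eq_of_geodesic (Γ := g.gamma (γ₁ u)) (a := u)
      (((g.isLeviCivitaOn _).contDiffAt_christoffel (mem_extChartAt_target _)).of_le (by simp))
      (hloc h₁ rfl) (hloc h₂ hu.1.1.symm) (by rw [hu.1.1])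
      ((velocity_eq_iff (hd h₁ huI) (hd h₂ huI) hu.1.1 hp).1 hu.1.2)
    refine nhdsWithin_mono u Ioi_subset_Ici_self ?_
    filter_upwards [h4, hI, hsrc h₁ rfl, hsrc h₂ hu.1.1.symm] with v hv hvI hv₁ hv₂
    have h5 : γ₁ v = γ₂ v := (extChartAt (𝓡 4) (γ₁ u)).injOn hv₁ hv₂ hv.1
    exact ⟨h5, (velocity_eq_iff (hd h₁ hvI) (hd h₂ hvI) h5 hv₁).2 hv.2⟩

end LorentzMetric

end

/-! ### The exponential map in the preferred chart -/

section

open Filter Topology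

section

variable {E F : Type*} [NormedAddCommGroup E] [NormedSpace ℝ E] [NormedAddCommGroup F]
  [NormedSpace ℝ F] {e : E → F} {w v : E} {r : ℝ}

theorem ContDiffAt.deriv_comp_smul (he : ContDiffAt ℝ 2 e v) (hv : r • w = v) :
    deriv (fun s : ℝ ↦ e (s • w)) =ᶠ[𝓝 r] fun s ↦ fderiv ℝ e (s • w) w := by
  subst hv
  have h1 : Tendsto (fun s : ℝ ↦ s • w) (𝓝 r) (𝓝 (r • w)) :=
    (continuous_id.smul continuous_const).tendsto r
  filter_upwards [h1.eventually (he.eventually (by simp))] with s hs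
  exact ((hs.differentiableAt (by simp)).hasFDerivAt.comp_hasDerivAt s
    (hasDerivAt_smul_const w s)).deriv

theorem ContDiffAt.deriv_deriv_comp_smul (he : ContDiffAt ℝ 2 e v) (hv : r • w = v) :
    deriv (deriv fun s : ℝ ↦ e (s • w)) r = fderiv ℝ (fderiv ℝ e) v w w := by
  subst hv
  have h2 : HasFDerivAt (fderiv ℝ e) (fderiv ℝ (fderiv ℝ e) (r • w)) (r • w) :=
    ((he.fderiv_right (m := 1) (by norm_num)).differentiableAt (by simp)).hasFDerivAt
  have h3 : HasDerivAt (fun s : ℝ ↦ fderiv ℝ e (s • w)) (fderiv ℝ (fderiv ℝ e) (r • w) w) r :=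
    h2.comp_hasDerivAt r (hasDerivAt_smul_const w r)
  rw [(he.deriv_comp_smul rfl).deriv_eq]
  exact (h3.clm_apply_const w).deriv

end

variable {M : Type*} [TopologicalSpace M] [ChartedSpace R4 M]

namespace LorentzMetric

variable {q : M} {γ : ℝ → M}

theorem velocity_comp_mul_left {t u : ℝ} (h : MDifferentiableAt 𝓘(ℝ, ℝ) (𝓡 4) γ (t * u)) :
    (velocity (fun s ↦ γ (t * s)) u : R4) = t • (velocity γ (t * u) : R4) := by
  have h0 : HasFDerivAt (fun s : ℝ ↦ t * s) (t • ContinuousLinearMap.id ℝ ℝ) u :=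
    (hasFDerivAt_id u).const_mul t
  have h1 := mfderiv_comp (I := 𝓘(ℝ, ℝ)) (I' := 𝓘(ℝ, ℝ)) (I'' := 𝓡 4) (g := γ)
    (f := fun s ↦ t * s) u h h0.differentiableAt.mdifferentiableAt
  rw [mfderiv_eq_fderiv, h0.fderiv] at h1
  refine (congrArg (fun A : ℝ →L[ℝ] R4 ↦ A 1) h1).trans ?_
  have h2 : ∀ A : ℝ →L[ℝ] R4, A (t • 1) = t • A 1 := fun A ↦ map_smul A t 1
  exact h2 _

variable [IsManifold (𝓡 4) ∞ M] {g : LorentzMetric M}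

theorem isGeodesicFrom_iff {v : R4} : g.IsGeodesicFrom q v γ ↔
    g.IsGeodesicOn γ (Icc 0 1) ∧ γ 0 = q ∧ (velocity γ 0 : R4) = v :=
  and_congr_right fun _ ↦ tangentBundle_ext_iff

theorem IsGeodesicOn.comp_mul_left (h : g.IsGeodesicOn γ (Icc 0 1)) {t : ℝ}
    (ht : t ∈ Icc (0 : ℝ) 1) : g.IsGeodesicOn (fun u ↦ γ (t * u)) (Icc 0 1) := by
  intro u hu
  obtain ⟨h1, h2⟩ := h (t * u)
    ⟨mul_nonneg ht.1 hu.1, mul_le_one₀ ht.2 hu.1 hu.2⟩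
  refine ⟨?_, fun p hp ↦ ?_⟩
  · exact ContMDiffAt.comp (I' := 𝓘(ℝ, ℝ)) u (g := γ) (f := fun s ↦ t * s) h1
      (contDiff_const.mul contDiff_id).contDiffAt.contMDiffAt
  · intro c k
    have hd : ∀ k : Fin 4, (deriv fun v ↦ c v k)
        = fun v ↦ t * deriv (fun v ↦ extChartAt (𝓡 4) p (γ v) k) (t * v) := fun k ↦
      funext fun v ↦ deriv_comp_mul_left t (fun v ↦ extChartAt (𝓡 4) p (γ v) k) v
    have h3 := h2 p hp k
    have h4 : deriv (deriv fun v ↦ c v k) u = t * (t * deriv (deriv fun v ↦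
        extChartAt (𝓡 4) p (γ v) k) (t * u)) := by
      rw [hd, deriv_const_mul_field]
      congr 1
      exact deriv_comp_mul_left t (deriv fun v ↦ extChartAt (𝓡 4) p (γ v) k) u
    rw [h4, eq_neg_of_add_eq_zero_left h3]
    simp only [hd]
    rw [mul_neg, mul_neg, neg_add_eq_zero, Finset.mul_sum, Finset.mul_sum]
    refine Finset.sum_congr rfl fun i _ ↦ ?_
    rw [Finset.mul_sum, Finset.mul_sum]
    exact Finset.sum_congr rfl fun j _ ↦ by ring

theorem IsGeodesicFrom.comp_mul_left {v : R4} (h : g.IsGeodesicFrom q v γ) {t : ℝ}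
    (ht : t ∈ Icc (0 : ℝ) 1) : g.IsGeodesicFrom q (t • v : R4) (fun u ↦ γ (t * u)) := by
  obtain ⟨h1, h2, h3⟩ := isGeodesicFrom_iff.1 h
  have h0 : MDifferentiableAt 𝓘(ℝ, ℝ) (𝓡 4) γ 0 :=
    (h1 0 ⟨le_rfl, zero_le_one⟩).1.mdifferentiableAt (by simp)
  refine isGeodesicFrom_iff.2 ⟨h1.comp_mul_left ht, by simpa using h2, ?_⟩
  rw [velocity_comp_mul_left (by simpa using h0), ← h3]
  congr 1
  exact congrArg (fun s ↦ (velocity γ s : R4)) (mul_zero t)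

theorem mfderiv_extChartAt_of_eq {y : M} (h : y = q) :
    (mfderiv (𝓡 4) 𝓘(ℝ, R4) (extChartAt (𝓡 4) q) y : R4 →L[ℝ] R4)
      = ContinuousLinearMap.id ℝ R4 := by
  have : IsManifold (𝓡 4) 1 M := .of_le (n := ∞) (by simp)
  subst h
  exact mfderiv_extChartAt_self

variable [T2Space M]

/-- Uniqueness makes the geodesic chosen in the definition of `exp` immaterial. -/
theorem IsGeodesicFrom.exp_eq {v : R4} (h : g.IsGeodesicFrom q v γ) : g.exp q v = γ 1 := by
  have hex : ∃ γ, g.IsGeodesicFrom q v γ := ⟨γ, h⟩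
  obtain ⟨h1, h2, h3⟩ := isGeodesicFrom_iff.1 h
  obtain ⟨h1', h2', h3'⟩ := isGeodesicFrom_iff.1 hex.choose_spec
  have h4 : g.exp q v = hex.choose 1 := dif_pos hex
  rw [h4]
  exact h1'.eqOn h1 (h2'.trans h2.symm) (h3'.trans h3.symm) ⟨zero_le_one, le_rfl⟩

theorem IsGeodesicFrom.exp_smul {v : R4} (h : g.IsGeodesicFrom q v γ) {t : ℝ}
    (ht : t ∈ Icc (0 : ℝ) 1) : g.exp q (t • v : R4) = γ t := by
  simpa using (h.comp_mul_left ht).exp_eq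

theorem exp_zero {V : Set R4} (h0 : (0 : R4) ∈ V) (hV : V ⊆ g.expDomain q) :
    g.exp q (0 : R4) = q := by
  obtain ⟨γ, hγ⟩ := hV h0
  have h1 := hγ.exp_smul (t := 0) ⟨le_rfl, zero_le_one⟩
  rw [zero_smul] at h1
  exact h1.trans (isGeodesicFrom_iff.1 hγ).2.1

/-- The exponential map at `q`, read in the preferred chart at `q`. -/
noncomputable def chartExp (g : LorentzMetric M) (q : M) (v : R4) : R4 :=
  extChartAt (𝓡 4) q (g.exp q v)

variable {V : Set R4}

theorem exists_contDiffOn_chartExp (hVo : IsOpen V) (h0 : (0 : R4) ∈ V) (hV : V ⊆ g.expDomain q)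
    (hexp : ContMDiffOn 𝓘(ℝ, R4) (𝓡 4) ∞ (fun v : R4 ↦ g.exp q v) V) :
    ∃ V' ⊆ V, IsOpen V' ∧ (0 : R4) ∈ V' ∧
      (∀ v ∈ V', g.exp q v ∈ (extChartAt (𝓡 4) q).source) ∧
      ContDiffOn ℝ ∞ (g.chartExp q) V' := by
  refine ⟨V ∩ (fun v : R4 ↦ g.exp q v) ⁻¹' (extChartAt (𝓡 4) q).source, inter_subset_left,
    hexp.continuousOn.isOpen_inter_preimage hVo (isOpen_extChartAt_source q), ⟨h0, ?_⟩,
    fun v hv ↦ hv.2, ?_⟩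
  · change g.exp q (0 : R4) ∈ (extChartAt (𝓡 4) q).source
    rw [exp_zero h0 hV]
    exact mem_extChartAt_source q
  · rw [← contMDiffOn_iff_contDiffOn]
    refine (contMDiffOn_extChartAt (I := 𝓡 4) (x := q)).comp (hexp.mono inter_subset_left)
      fun v hv ↦ ?_
    rw [← extChartAt_source (𝓡 4)]
    exact hv.2

theorem chartExp_zero (h0 : (0 : R4) ∈ V) (hV : V ⊆ g.expDomain q) :
    g.chartExp q 0 = extChartAt (𝓡 4) q q :=
  congrArg (extChartAt (𝓡 4) q) (exp_zero h0 hV)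

/-- For `v ∈ V` the curve `s ↦ exp_q(sv)` is the geodesic with initial velocity `v`, and the
preferred chart has identity differential at `q`. The curves are known to agree only on `[0,1]`, so
derivatives at `0` are compared from the right; linearity extends the result from `V` to all
vectors. -/
theorem fderiv_chartExp_zero (hVo : IsOpen V) (h0 : (0 : R4) ∈ V) (hV : V ⊆ g.expDomain q)
    (he : ContDiffOn ℝ ∞ (g.chartExp q) V) :
    fderiv ℝ (g.chartExp q) 0 = ContinuousLinearMap.id ℝ R4 := by
  have hV0 := hVo.mem_nhds h0
  have he0 : HasFDerivAt (g.chartExp q) (fderiv ℝ (g.chartExp q) 0) 0 :=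
    ((he.contDiffAt hV0).differentiableAt (by simp)).hasFDerivAt
  have key : ∀ v ∈ V, fderiv ℝ (g.chartExp q) 0 v = v := by
    intro v hv
    obtain ⟨γ, hγ⟩ := hV hv
    obtain ⟨h1, h2, h3⟩ := isGeodesicFrom_iff.1 hγ
    have hm := (h1 0 ⟨le_rfl, zero_le_one⟩).1
    have hs : γ 0 ∈ (extChartAt (𝓡 4) q).source := by
      rw [h2]
      exact mem_extChartAt_source q
    have h4 : HasDerivAt (fun s : ℝ ↦ extChartAt (𝓡 4) q (γ s)) v 0 := by
      have h5 := deriv_chart_comp (hm.mdifferentiableAt (by simp)) hs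
      have h6 : (mfderiv (𝓡 4) 𝓘(ℝ, R4) (extChartAt (𝓡 4) q) (γ 0) : R4 →L[ℝ] R4)
          = ContinuousLinearMap.id ℝ R4 := mfderiv_extChartAt_of_eq h2
      have h7 : deriv (fun s : ℝ ↦ extChartAt (𝓡 4) q (γ s)) 0 = v :=
        h5.trans ((congrArg (fun A : R4 →L[ℝ] R4 ↦ A (velocity γ 0 : R4)) h6).trans h3)
      rw [← h7]
      exact ((contDiffAt_chart_comp two_le_infty hm hs).differentiableAt (by simp)).hasDerivAt
    have h8 : HasDerivAt (fun s : ℝ ↦ g.chartExp q (s • v)) (fderiv ℝ (g.chartExp q) 0 v) 0 := by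
      have h9 : HasFDerivAt (g.chartExp q) (fderiv ℝ (g.chartExp q) 0) ((0 : ℝ) • v) := by
        rwa [zero_smul]
      exact h9.comp_hasDerivAt (0 : ℝ) (hasDerivAt_smul_const v 0)
    have h10 : UniqueDiffWithinAt ℝ (Icc (0 : ℝ) 1) 0 :=
      uniqueDiffOn_Icc zero_lt_one _ ⟨le_rfl, zero_le_one⟩
    refine h10.eq_deriv _ (h8.hasDerivWithinAt.congr_of_mem (fun s hs ↦ ?_)
      ⟨le_rfl, zero_le_one⟩) h4.hasDerivWithinAt
    exact congrArg (extChartAt (𝓡 4) q) (hγ.exp_smul hs).symm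
  ext1 v
  have hc : Tendsto (fun s : ℝ ↦ s • v) (𝓝[≠] 0) (𝓝 0) := by
    have : Tendsto (fun s : ℝ ↦ s • v) (𝓝 0) (𝓝 ((0 : ℝ) • v)) :=
      (continuous_id.smul continuous_const).tendsto 0
    rw [zero_smul] at this
    exact this.mono_left nhdsWithin_le_nhds
  obtain ⟨s, hs, hs0⟩ := ((hc.eventually hV0).and self_mem_nhdsWithin).exists
  have h1 := key _ hs
  rw [map_smul] at h1
  exact smul_right_injective R4 hs0 h1

/-- In the preferred chart, `t ↦ exp_q (t v)` solves the geodesic equation. -/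
theorem chartExp_geodesic (hVo : IsOpen V) (h0 : (0 : R4) ∈ V) (hV : V ⊆ g.expDomain q)
    (hs : ∀ v ∈ V, g.exp q v ∈ (extChartAt (𝓡 4) q).source)
    (he : ContDiffOn ℝ ∞ (g.chartExp q) V) : ∀ᶠ v in 𝓝 (0 : R4),
      fderiv ℝ (fderiv ℝ (g.chartExp q)) v v v + g.gamma q (g.chartExp q v)
        (fderiv ℝ (g.chartExp q) v v) (fderiv ℝ (g.chartExp q) v v) = 0 := by
  -- The geodesic with initial vector `2v` is used at time `1/2`, an interior point of `[0,1]`.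
  -- There it agrees with `s ↦ e(s · 2v)` on a full neighbourhood, so both derivatives may be
  -- compared; the resulting factor `4` cancels.
  have h2V : ∀ᶠ v in 𝓝 (0 : R4), (2 : ℝ) • v ∈ V := by
    have : Tendsto (fun v : R4 ↦ (2 : ℝ) • v) (𝓝 0) (𝓝 ((2 : ℝ) • 0)) :=
      (continuous_const_smul (2 : ℝ)).tendsto 0
    rw [smul_zero] at this
    exact this.eventually (hVo.mem_nhds h0)
  filter_upwards [h2V, hVo.mem_nhds h0] with v hv2 hv
  set e := g.chartExp q with hedef
  obtain ⟨γ, hγ⟩ := hV hv2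
  have h1 := (isGeodesicFrom_iff.1 hγ).1
  set c : ℝ → R4 := fun s ↦ extChartAt (𝓡 4) q (γ s) with hc
  have hhalf : (1 / 2 : ℝ) ∈ Icc (0 : ℝ) 1 := by norm_num
  have hv' : (1 / 2 : ℝ) • (2 : ℝ) • v = v := by simp [smul_smul]
  have hcs : ∀ s ∈ Icc (0 : ℝ) 1, c s = e (s • (2 : ℝ) • v) := fun s hs ↦
    congrArg (extChartAt (𝓡 4) q) (hγ.exp_smul hs).symm
  have hnear : ∀ᶠ s in 𝓝 (1 / 2 : ℝ), s ∈ Icc (0 : ℝ) 1 :=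
    Icc_mem_nhds (by norm_num) (by norm_num)
  have he2 : ContDiffAt ℝ 2 e v := (he.contDiffAt (hVo.mem_nhds hv)).of_le two_le_infty
  have hce : c =ᶠ[𝓝 (1 / 2)] fun s : ℝ ↦ e (s • (2 : ℝ) • v) := hnear.mono hcs
  have hd1 : deriv c (1 / 2) = fderiv ℝ e v ((2 : ℝ) • v) := by
    rw [hce.deriv_eq, (he2.deriv_comp_smul hv').self_of_nhds]
    simp only [hv']
  have hd2 : deriv (deriv c) (1 / 2) = fderiv ℝ (fderiv ℝ e) v ((2 : ℝ) • v) ((2 : ℝ) • v) := by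
    rw [hce.deriv.deriv_eq, he2.deriv_deriv_comp_smul hv']
  have hsrc : γ (1 / 2) ∈ (extChartAt (𝓡 4) q).source := by
    rw [← hγ.exp_smul hhalf, hv']
    exact hs v hv
  have h4 := h1.chart hhalf hsrc
  have hce' : extChartAt (𝓡 4) q (γ (1 / 2)) = e v := by
    rw [← hv']
    exact hcs _ hhalf
  rw [← hc, hd1, hd2, hce'] at h4
  simp only [map_smul, smul_apply, ← smul_add] at h4
  exact (smul_eq_zero_iff_right two_ne_zero).1 ((smul_eq_zero_iff_right two_ne_zero).1 h4)

end LorentzMetric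

end

/-! ### Length of geodesic segments in a convex normal neighbourhood -/

section

open Filter Topology

set_option maxSynthPendingDepth 2 in
/-- Geodesics have constant speed. -/
theorem IsLeviCivitaOn.hasDerivAt_speed {E : Type*} [NormedAddCommGroup E] [NormedSpace ℝ E]
    {G : E → E →L[ℝ] E →L[ℝ] ℝ} {Γ : E → E →L[ℝ] E →L[ℝ] E} {s : Set E}
    (h : IsLeviCivitaOn G Γ s) {c : ℝ → E} {u : ℝ} (hc : ContDiffAt ℝ 2 c u) (hs : c u ∈ s)
    (hgeo : deriv (deriv c) u + Γ (c u) (deriv c u) (deriv c u) = 0) :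
    HasDerivAt (fun v ↦ G (c v) (deriv c v) (deriv c v)) 0 u := by
  have h1 := (hc.differentiableAt (by simp)).hasDerivAt
  have h2 := (hc.deriv_one.differentiableAt (by simp)).hasDerivAt
  rw [eq_neg_of_add_eq_zero_left hgeo] at h2
  have h3 : HasDerivAt (fun v ↦ G (c v)) (fderiv ℝ G (c u) (deriv c u)) u :=
    (h.hasFDerivAt_metric hs).comp_hasDerivAt u h1
  have h4 := (h3.clm_apply h2).clm_apply h2
  have h5 : (fderiv ℝ G (c u) (deriv c u) (deriv c u)
      + G (c u) (-(Γ (c u) (deriv c u) (deriv c u)))) (deriv c u)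
      + G (c u) (deriv c u) (-(Γ (c u) (deriv c u) (deriv c u))) = 0 := by
    simp only [map_neg, add_apply, neg_apply, h.compat hs]
    ring
  rwa [h5] at h4

variable {M : Type*} [TopologicalSpace M] [ChartedSpace R4 M] [IsManifold (𝓡 4) ∞ M]

namespace LorentzMetric

theorem frame_self (q : M) (v : R4) : (frame q (extChartAt (𝓡 4) q q) v : R4) = v := by
  have : IsManifold (𝓡 4) 1 M := .of_le (n := ∞) (by simp)
  have h1 := mfderiv_extChartAt_comp_mfderivWithin_extChartAt_symm (I := 𝓡 4)
    (mem_extChartAt_target (I := 𝓡 4) q)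
  rw [ModelWithCorners.range_eq_univ, mfderivWithin_univ] at h1
  have h2 := mfderiv_extChartAt_of_eq (extChartAt_to_inv (I := 𝓡 4) q)
  have h3 := congrArg (fun A : R4 →L[ℝ] R4 ↦ A v) h1
  exact (congrArg (fun A : R4 →L[ℝ] R4 ↦ A (frame q (extChartAt (𝓡 4) q q) v)) h2).symm.trans h3

variable {g : LorentzMetric M} {q : M} {U : Set M}

theorem form_self (v w : R4) : g.form q (extChartAt (𝓡 4) q q) v w = g.val q v w := by
  rw [form_eq_val]
  exact g.val_congr (extChartAt_to_inv (I := 𝓡 4) q) (frame_self q v) (frame_self q w)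

theorem val_velocity {p : M} {γ : ℝ → M} {u : ℝ} (hγ : MDifferentiableAt 𝓘(ℝ, ℝ) (𝓡 4) γ u)
    (hp : γ u ∈ (extChartAt (𝓡 4) p).source) : g.val (γ u) (velocity γ u) (velocity γ u)
      = g.form p (extChartAt (𝓡 4) p (γ u)) (deriv (fun v ↦ extChartAt (𝓡 4) p (γ v)) u)
        (deriv (fun v ↦ extChartAt (𝓡 4) p (γ v)) u) := by
  rw [form_eq_val]
  exact g.val_congr ((extChartAt (𝓡 4) p).left_inv hp).symm (velocity_eq_frame hγ hp)
    (velocity_eq_frame hγ hp)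

/-- The length of a geodesic is its initial speed. -/
theorem IsGeodesicOn.length_eq {p : M} {γ : ℝ → M} (h : g.IsGeodesicOn γ (Icc 0 1))
    (hp : ∀ u ∈ Icc (0 : ℝ) 1, γ u ∈ (extChartAt (𝓡 4) p).source) :
    g.length γ = √|g.form p (extChartAt (𝓡 4) p (γ 0))
      (deriv (fun v ↦ extChartAt (𝓡 4) p (γ v)) 0)
      (deriv (fun v ↦ extChartAt (𝓡 4) p (γ v)) 0)| := by
  set c : ℝ → R4 := fun v ↦ extChartAt (𝓡 4) p (γ v) with hc
  have hd : ∀ u ∈ Icc (0 : ℝ) 1,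
      HasDerivAt (fun v ↦ g.form p (c v) (deriv c v) (deriv c v)) 0 u := fun u hu ↦
    (g.isLeviCivitaOn p).hasDerivAt_speed (contDiffAt_chart_comp two_le_infty (h u hu).1 (hp u hu))
      ((extChartAt (𝓡 4) p).map_source (hp u hu)) (h.chart hu (hp u hu))
  have hconst := constant_of_has_deriv_right_zero
    (fun u hu ↦ (hd u hu).continuousAt.continuousWithinAt)
    (fun u hu ↦ (hd u (Ico_subset_Icc_self hu)).hasDerivWithinAt)
  rw [length]
  have h1 : EqOn (fun u ↦ √|g.val (γ u) (velocity γ u) (velocity γ u)|)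
      (fun _ ↦ √|g.form p (c 0) (deriv c 0) (deriv c 0)|) (uIcc 0 1) := by
    intro u hu
    rw [uIcc_of_le zero_le_one] at hu
    simp only
    rw [val_velocity ((h u hu).1.mdifferentiableAt (by simp)) (hp u hu), ← hconst u hu]
  rw [intervalIntegral.integral_congr h1, intervalIntegral.integral_const, sub_zero, one_smul]

theorem IsConvexNormalNhd.isGeodesicSegment_eqOn (hU : g.IsConvexNormalNhd q U) {p r : M}
    {χ χ' : ℝ → M} (hp : p ∈ U) (hr : r ∈ U) (h : g.IsGeodesicSegment U p r χ)
    (h' : g.IsGeodesicSegment U p r χ') : EqOn χ χ' (Icc 0 1) := by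
  obtain ⟨χ₁, -, h₁⟩ := hU.exists_unique_geodesic p hp r hr
  exact (h₁ χ h).trans (h₁ χ' h').symm

/-- A solution of the geodesic equation in a chart is the geodesic segment between its end
points. -/
theorem IsConvexNormalNhd.segment_of_chart (hU : g.IsConvexNormalNhd q U) {p r : M} {c : ℝ → R4}
    (hp : p ∈ U) (hr : r ∈ U) (hps : p ∈ (extChartAt (𝓡 4) q).source)
    (hrs : r ∈ (extChartAt (𝓡 4) q).source) (hc : ContDiff ℝ 2 c)
    (h0 : c 0 = extChartAt (𝓡 4) q p) (h1 : c 1 = extChartAt (𝓡 4) q r)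
    (hN : ∀ u ∈ Icc (0 : ℝ) 1, c u ∈ (extChartAt (𝓡 4) q).target ∧
      (extChartAt (𝓡 4) q).symm (c u) ∈ U)
    (hgeo : ∀ u ∈ Icc (0 : ℝ) 1,
      deriv (deriv c) u + g.gamma q (c u) (deriv c u) (deriv c u) = 0) :
    (∃ χ, g.IsGeodesicSegment U p r χ) ∧ ∀ χ, g.IsGeodesicSegment U p r χ →
      g.length χ = √|g.form q (c 0) (deriv c 0) (deriv c 0)| := by
  have hseg : g.IsGeodesicSegment U p r (fun u ↦ (extChartAt (𝓡 4) q).symm (c u)) :=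
    ⟨g.isGeodesicOn_of_chart q (fun u _ ↦ hc.contDiffAt) (fun u hu ↦ (hN u hu).1) hgeo,
      by simp only [h0, (extChartAt (𝓡 4) q).left_inv hps],
      by simp only [h1, (extChartAt (𝓡 4) q).left_inv hrs], fun u hu ↦ (hN u hu).2⟩
  refine ⟨⟨_, hseg⟩, fun χ hχ ↦ ?_⟩
  have heq := hU.isGeodesicSegment_eqOn hp hr hχ hseg
  have hsrc : ∀ u ∈ Icc (0 : ℝ) 1, χ u ∈ (extChartAt (𝓡 4) q).source := fun u hu ↦ by
    rw [heq hu]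
    exact (extChartAt (𝓡 4) q).map_target (hN u hu).1
  have heq' : EqOn (fun u ↦ extChartAt (𝓡 4) q (χ u)) c (Icc 0 1) := fun u hu ↦ by
    simp only [heq hu, (extChartAt (𝓡 4) q).right_inv (hN u hu).1]
  have h0I : (0 : ℝ) ∈ Icc (0 : ℝ) 1 := ⟨le_rfl, zero_le_one⟩
  -- `χ` is determined only on `[0,1]`, yet its two-sided derivative at `0` exists and so equals the
  -- derivative from the right.
  have hd : deriv (fun u ↦ extChartAt (𝓡 4) q (χ u)) 0 = deriv c 0 := by
    have h2 := ((contDiffAt_chart_comp two_le_infty (hχ.1 0 h0I).1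
      (hsrc 0 h0I)).differentiableAt (by simp)).hasDerivAt
    exact (uniqueDiffOn_Icc zero_lt_one 0 h0I).eq_deriv _ h2.hasDerivWithinAt
      (((hc.differentiable (by simp)) 0).hasDerivAt.hasDerivWithinAt.congr_of_mem heq' h0I)
  rw [hχ.1.length_eq hsrc, hd, show extChartAt (𝓡 4) q (χ 0) = c 0 from heq' h0I]

theorem exists_Ico_of_eventually {P : ℝ × ℝ → Prop} (h : ∀ᶠ z in 𝓝 (0 : ℝ × ℝ), P z) :
    ∃ ε > (0 : ℝ), ε ≤ 1 ∧ ∀ t ∈ Ico 0 ε, ∀ w ∈ Ico 0 ε, P (t, w) := by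
  obtain ⟨ε, hε, h⟩ := Metric.eventually_nhds_iff.1 h
  refine ⟨min ε 1, lt_min hε zero_lt_one, min_le_right _ _, fun t ht w hw ↦ h ?_⟩
  rw [dist_zero_right, Prod.norm_def, max_lt_iff, Real.norm_of_nonneg ht.1,
    Real.norm_of_nonneg hw.1]
  exact ⟨ht.2.trans_le (min_le_left _ _), hw.2.trans_le (min_le_left _ _)⟩

end LorentzMetric

end

/-! ### Conclusion on the manifold -/

open Filter Topology in
theorem LorentzMetric.IsConvexNormalNhd.exists_length {M : Type*} [TopologicalSpace M] [T2Space M]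
    [ChartedSpace R4 M] [IsManifold (𝓡 4) ∞ M] {g : LorentzMetric M} {q : M} {U : Set M}
    (hU : g.IsConvexNormalNhd q U) (X Y : R4) (hY : g.val q Y Y = -1) :
    ∃ S : ℝ × ℝ → ℝ, ContDiff ℝ 6 S ∧ S 0 = 1 ∧ deriv (fun t ↦ S (t, 0)) 0 = 0 ∧
      deriv (deriv fun t ↦ S (t, 0)) 0 = -(g.sectional q X Y) / 3 ∧ ∃ ε > (0 : ℝ), ε ≤ 1 ∧
      ∀ t ∈ Ico 0 ε, ∀ w ∈ Ico 0 ε,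
        t • (Real.cos w • X + Real.sin w • Y) ∈ g.expDomain q ∧
        g.exp q (t • (Real.cos w • X + Real.sin w • Y)) ∈ U ∧
        (∃ χ, g.IsGeodesicSegment U (g.exp q (t • X))
          (g.exp q (t • (Real.cos w • X + Real.sin w • Y))) χ) ∧
        ∀ χ, g.IsGeodesicSegment U (g.exp q (t • X))
          (g.exp q (t • (Real.cos w • X + Real.sin w • Y))) χ →
          g.length χ = t * w * S (t, w) := by
  obtain ⟨V, -, hVo, h0V, hV, hbij, -, hexp, -⟩ := hU.exists_diffeo
  obtain ⟨V', hV'V, hV'o, h0V', hsrc, he⟩ := exists_contDiffOn_chartExp hVo h0V hV hexp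
  have hV' := hV'V.trans hV
  have hqU : q ∈ U := exp_zero h0V hV ▸ hbij.mapsTo h0V
  obtain ⟨S, hS, hS0, hS1, hS2, hgeo⟩ := (g.isLeviCivitaOn q).exists_length
    (mem_extChartAt_target (I := 𝓡 4) q) he (hV'o.mem_nhds h0V') (chartExp_zero h0V hV)
    (fderiv_chartExp_zero hV'o h0V' hV' he) (chartExp_geodesic hV'o h0V' hV' hsrc he) X Y
    ((form_self Y Y).trans hY)
  rw [← g.sectional_eq] at hS2
  refine ⟨S, hS, hS0, hS1, hS2, ?_⟩
  -- Solutions confined to this neighbourhood stay in the chart and in `U`, so uniqueness of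
  -- segments in `U` applies to them.
  have hN : ∀ᶠ x in 𝓝 (extChartAt (𝓡 4) q q), x ∈ (extChartAt (𝓡 4) q).target ∧
      (extChartAt (𝓡 4) q).symm x ∈ U := by
    filter_upwards [extChartAt_target_mem_nhds (I := 𝓡 4) q,
      (continuousAt_extChartAt_symm (I := 𝓡 4) q).preimage_mem_nhds
        (hU.isOpen.mem_nhds (by rwa [extChartAt_to_inv]))] with x h1 h2 using ⟨h1, h2⟩
  have hend : ∀ᶠ z in 𝓝 (0 : ℝ × ℝ), z.1 • X ∈ V' ∧
      z.1 • (Real.cos z.2 • X + Real.sin z.2 • Y) ∈ V' := by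
    have h1 : ContinuousAt (fun z : ℝ × ℝ ↦ z.1 • X) 0 := by fun_prop
    have h2 : ContinuousAt (fun z : ℝ × ℝ ↦ z.1 • (Real.cos z.2 • X + Real.sin z.2 • Y)) 0 := by
      fun_prop
    exact (h1.eventually (hV'o.mem_nhds (by simpa using h0V'))).and
      (h2.eventually (hV'o.mem_nhds (by simpa using h0V')))
  have hpos : ∀ᶠ z in 𝓝 (0 : ℝ × ℝ), 0 < S z :=
    hS.continuous.continuousAt.eventually (lt_mem_nhds (by rw [hS0]; exact one_pos))
  obtain ⟨ε, hε, hε1, h⟩ := exists_Ico_of_eventually ((hgeo _ hN).and (hend.and hpos))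
  refine ⟨ε, hε, hε1, fun t ht w hw ↦ ?_⟩
  obtain ⟨⟨c, hc, hc0, hc1, hcN, hlen⟩, ⟨hX, hXw⟩, hSpos⟩ := h t ht w hw
  have hp : g.exp q (t • X) ∈ U := hbij.mapsTo (hV'V hX)
  have hr : g.exp q (t • (Real.cos w • X + Real.sin w • Y)) ∈ U := hbij.mapsTo (hV'V hXw)
  have hseg := hU.segment_of_chart hp hr (hsrc _ hX) (hsrc _ hXw) hc hc0 hc1
    (fun u hu ↦ (hcN u hu).1) (fun u hu ↦ (hcN u hu).2)
  refine ⟨hV' hXw, hr, hseg.1, fun χ hχ ↦ (hseg.2 χ hχ).trans ?_⟩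
  rw [hlen, abs_of_nonneg (mul_nonneg ht.1 hw.1)]

theorem lemma2p2p1 {M : Type*} [TopologicalSpace M] [T2Space M] [ChartedSpace R4 M]
    [IsManifold (𝓡 4) ∞ M] (g : LorentzMetric M) (q : M) (U : Set M)
    (hU : g.IsConvexNormalNhd q U) (X Y : TangentSpace (𝓡 4) q)
    (hX : g.val q X X = -1) (hY : g.val q Y Y = -1) (hXY : g.val q X Y = 0) :
    ∃ ε > (0 : ℝ), ∃ C : ℝ, ∃ L : ℝ → ℝ → ℝ,
      -- the end points lie in `U`, and `L t w` is the length of the geodesic `χ` joining them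
      (∀ t ∈ Ico 0 ε, ∀ w ∈ Ico 0 ε,
        t • (Real.cos w • X + Real.sin w • Y) ∈ g.expDomain q ∧
        g.exp q (t • (Real.cos w • X + Real.sin w • Y)) ∈ U ∧
        (∃ χ, g.IsGeodesicSegment U (g.exp q (t • X))
          (g.exp q (t • (Real.cos w • X + Real.sin w • Y))) χ) ∧
        ∀ χ, g.IsGeodesicSegment U (g.exp q (t • X))
          (g.exp q (t • (Real.cos w • X + Real.sin w • Y))) χ → g.length χ = L t w) ∧
      -- the expansion of the length
      (∀ t ∈ Ioo 0 ε, ∀ w ∈ Ico 0 ε, ∃ r₁ r₂ : ℝ, |r₁| ≤ C * t ^ 3 ∧ |r₂| ≤ C * w ∧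
        L t w = t * w * (1 - t ^ 2 / 6 * g.sectional q X Y + r₁ + r₂)) ∧
      -- the length has the derivatives that are used below, and they give the curvature
      ContDiffOn ℝ 6 (fun z : ℝ × ℝ ↦ L z.1 z.2) (Ico 0 ε ×ˢ Ico 0 ε) ∧
      g.sectional q X Y = -iteratedDerivWithin 3
        (fun t ↦ derivWithin (fun w ↦ L t w) (Ici 0) 0) (Ici 0) 0 ∧
      g.sectional q X Y = -(1 / 16) * iteratedDerivWithin 4
        (fun t ↦ iteratedDerivWithin 2 (fun w ↦ L t w ^ 2) (Ici 0) 0) (Ici 0) 0 := by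
  obtain ⟨S, hS, hS0, hS1, hS2, ε, hε, hε1, hlen⟩ := hU.exists_length X Y hY
  obtain ⟨⟨C, hC⟩, hL, h3, h4⟩ := length_expansion hS hS0 hS1 hS2
  -- `L` is given by the formula on the whole plane, so that the derivatives along `Ici 0` are those
  -- of a `C⁶` function; it is a length only for small parameters.
  refine ⟨ε, hε, C, fun t w ↦ t * w * S (t, w), hlen, fun t ht w hw ↦ ?_, hL.contDiffOn, h3, h4⟩
  exact hC t ⟨ht.1.le, ht.2.le.trans hε1⟩ w ⟨hw.1, hw.2.le.trans hε1⟩
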